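/- Let $r\geqslant 3$ be an integer, let $q=e^{2\pi i/r}$, and set $r'=r/\gcd(r,2)$ and $r''=r/\gcd(r,4)$. For integers $k$ and $n\geqslant 0$ write $\{k\}=q^k-q^{-k}$, $[k]=\{k\}/\{1\}$, $[n]!=[n][n-1]\cdots[1]$. Let $u_q\mathfrak{sl}_2$ be the Hopf algebra over $\mathbb{C}$ with generators $K,K^{-1},E,F$, relations \[ KK^{-1}=K^{-1}K=1,\quad KEK^{-1}=q^2E,\quad KFK^{-1}=q^{-2}F,\quad [E,F]=\frac{K-K^{-1}}{q-q^{-1}},\quad K^{r'}=1,\quad E^{r'}=F^{r'}=0, \] and coproduct, counit and antipode \[ \Delta(K)=K\otimes K,\quad \Delta(E)=E\otimes K+1\otimes E,\quad \Delta(F)=F\otimes 1+K^{-1}\otimes F, \] \[ \varepsilon(K)=1,\quad \varepsilon(E)=\varepsilon(F)=0,\quad S(K)=K^{-1},\quad S(E)=-EK^{-1},\quad S(F)=-KF. \] Let \[ R=\sum_i R'_i\otimes R''_i=\frac{1}{r'}\sum_{a,b,c=0}^{r'-1}\frac{\{1\}^a}{[a]!}\,q^{\frac{a(a-1)}{2}-2bc}\,K^bE^a\otimes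 K^cF^a \] be its R-matrix, $u=\sum_i S(R''_i)R'_i$ its Drinfeld element, and $v_+=uK^{-1}$ its ribbon element (corresponding to the pivotal element $K$). There is a unique linear form $\lambda$ on $u_q\mathfrak{sl}_2$ such that \[ \lambda(E^aF^bK^c)=\frac{\sqrt{r''}\,[r'-1]!}{\{1\}^{r'-1}}\,\delta_{a,r'-1}\,\delta_{b,r'-1}\,\delta_{c,r'-1}\qquad(0\leqslant a,b,c\leqslant r'-1). \] It is a left integral, that is, $\lambda(x_{(2)})x_{(1)}=\lambda(x)1$ for every $x\in u_q\mathfrak{sl}_2$, and the positive stabilization coefficient $\lambda(v_+)$ is given by \[ \lambda(v_+)=\begin{cases} i^{\frac{r-1}{2}}q^{\frac{r+3}{2}} & \text{if } r\equiv 1 \bmod 2,\\ \left(\frac{2}{r'}\right)i^{\frac{r'-1}{2}}q^{\frac{r'+3}{2}} & \text{if } r\equiv 2\bmod 4,\\ -q^{\frac{r''+3}{2}} & \text{if } r\equiv 4\bmod 8,\\ 0 & \text{if } r\equiv 0\bmod 8, \end{cases} \] where $\left(\frac{2}{r'}\right)$ denotes the Jacobi symbol of $2$ modulo $r'$. -/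

import Mathlib

open scoped TensorProduct

namespace SmallQuantum

noncomputable section

/-! ### Scalars -/

/-- The root of unity `q = exp (2πi / r)`. -/
def q (r : ℕ) : ℂ := Complex.exp (2 * Real.pi * Complex.I / r)

/-- `r' = r / gcd(r, 2)`. -/
def r' (r : ℕ) : ℕ := r / Nat.gcd r 2

/-- `r'' = r / gcd(r, 4)`. -/
def r'' (r : ℕ) : ℕ := r / Nat.gcd r 4

/-- The quantum number `{k} = q^k - q^(-k)`. -/
def qBrace (r : ℕ) (k : ℤ) : ℂ := q r ^ k - q r ^ (-k)

/-- The quantum integer `[k] = {k} / {1}`. -/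
def qInt (r : ℕ) (k : ℤ) : ℂ := qBrace r k / qBrace r 1

/-- The quantum factorial `[n]! = [n] [n-1] ⋯ [1]`. -/
def qFact (r : ℕ) (n : ℕ) : ℂ := ∏ k ∈ Finset.range n, qInt r ((k : ℤ) + 1)

lemma q_ne_zero (r : ℕ) : q r ≠ 0 := Complex.exp_ne_zero _

lemma isPrimitiveRoot_q_sq {r : ℕ} (hr : r ≠ 0) : IsPrimitiveRoot (q r ^ 2) (r' r) := by
  have h : IsPrimitiveRoot (q r) r := Complex.isPrimitiveRoot_exp r hr
  rcases Nat.even_or_odd r with he | ho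
  · obtain ⟨m, hm⟩ := he.two_dvd
    have h2 : r' r = m := by
      have : Nat.gcd r 2 = 2 := Nat.gcd_eq_right ⟨m, hm⟩
      rw [r', this, hm]; omega
    rw [h2]
    exact h.pow (Nat.pos_of_ne_zero hr) hm
  · have hc : Nat.Coprime 2 r := (Nat.coprime_two_left).2 ho
    have h2 : r' r = r := by
      have : Nat.gcd r 2 = 1 := hc.symm
      rw [r', this, Nat.div_one]
    rw [h2]
    exact h.pow_of_coprime 2 hc

/-! ### The algebra `u_q sl₂` by generators and relations -/

/-- The generators. -/
inductive Gen
  | K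
  | Kinv
  | E
  | F

/-- The free generators. -/
abbrev fg (x : Gen) : FreeAlgebra ℂ Gen := FreeAlgebra.ι ℂ x

/-- The defining relations of `u_q sl₂`. -/
inductive Rel (r : ℕ) : FreeAlgebra ℂ Gen → FreeAlgebra ℂ Gen → Prop
  | K_Kinv : Rel r (fg .K * fg .Kinv) 1
  | Kinv_K : Rel r (fg .Kinv * fg .K) 1
  | K_E : Rel r (fg .K * fg .E * fg .Kinv) (q r ^ 2 • fg .E)
  | K_F : Rel r (fg .K * fg .F * fg .Kinv) ((q r ^ 2)⁻¹ • fg .F)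
  | E_F : Rel r (fg .E * fg .F - fg .F * fg .E) ((q r - (q r)⁻¹)⁻¹ • (fg .K - fg .Kinv))
  | K_pow : Rel r (fg .K ^ r' r) 1
  | E_pow : Rel r (fg .E ^ r' r) 0
  | F_pow : Rel r (fg .F ^ r' r) 0

/-- The small quantum group `u_q sl₂` at `q = exp (2πi / r)`. -/
def Uq (r : ℕ) : Type := RingQuot (Rel r)

instance (r : ℕ) : Ring (Uq r) := inferInstanceAs (Ring (RingQuot (Rel r)))

instance (r : ℕ) : Algebra ℂ (Uq r) := inferInstanceAs (Algebra ℂ (RingQuot (Rel r)))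

/-- The quotient map from the free algebra. -/
def mk (r : ℕ) : FreeAlgebra ℂ Gen →ₐ[ℂ] Uq r := RingQuot.mkAlgHom ℂ (Rel r)

/-- The generator `K`. -/
def K (r : ℕ) : Uq r := mk r (fg .K)

/-- The generator `K⁻¹`. -/
def Kinv (r : ℕ) : Uq r := mk r (fg .Kinv)

/-- The generator `E`. -/
def E (r : ℕ) : Uq r := mk r (fg .E)

/-- The generator `F`. -/
def F (r : ℕ) : Uq r := mk r (fg .F)

lemma mk_rel {r : ℕ} {x y : FreeAlgebra ℂ Gen} (h : Rel r x y) : mk r x = mk r y :=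
  RingQuot.mkAlgHom_rel ℂ h

lemma K_mul_Kinv (r : ℕ) : K r * Kinv r = 1 := by
  simpa [K, Kinv] using mk_rel (Rel.K_Kinv (r := r))

lemma Kinv_mul_K (r : ℕ) : Kinv r * K r = 1 := by
  simpa [K, Kinv] using mk_rel (Rel.Kinv_K (r := r))

lemma K_E_Kinv (r : ℕ) : K r * E r * Kinv r = q r ^ 2 • E r := by
  simpa [K, Kinv, E] using mk_rel (Rel.K_E (r := r))

lemma K_F_Kinv (r : ℕ) : K r * F r * Kinv r = (q r ^ 2)⁻¹ • F r := by
  simpa [K, Kinv, F] using mk_rel (Rel.K_F (r := r))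

lemma E_F_comm (r : ℕ) :
    E r * F r - F r * E r = (q r - (q r)⁻¹)⁻¹ • (K r - Kinv r) := by
  simpa [K, Kinv, E, F] using mk_rel (Rel.E_F (r := r))

lemma K_pow (r : ℕ) : K r ^ r' r = 1 := by
  simpa [K] using mk_rel (Rel.K_pow (r := r))

lemma E_pow (r : ℕ) : E r ^ r' r = 0 := by
  simpa [E] using mk_rel (Rel.E_pow (r := r))

lemma F_pow (r : ℕ) : F r ^ r' r = 0 := by
  simpa [F] using mk_rel (Rel.F_pow (r := r))

lemma Kinv_pow (r : ℕ) : Kinv r ^ r' r = 1 := by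
  have hc : Commute (K r) (Kinv r) := by rw [Commute, SemiconjBy, K_mul_Kinv, Kinv_mul_K]
  have h := hc.mul_pow (r' r)
  rw [K_mul_Kinv, K_pow, one_pow, one_mul] at h
  exact h.symm

lemma K_mul_E (r : ℕ) : K r * E r = q r ^ 2 • (E r * K r) := by
  have h := congrArg (· * K r) (K_E_Kinv r)
  simpa [mul_assoc, Kinv_mul_K] using h

lemma K_mul_F (r : ℕ) : K r * F r = (q r ^ 2)⁻¹ • (F r * K r) := by
  have h := congrArg (· * K r) (K_F_Kinv r)
  simpa [mul_assoc, Kinv_mul_K] using h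

lemma E_mul_Kinv (r : ℕ) : E r * Kinv r = q r ^ 2 • (Kinv r * E r) := by
  have h := congrArg (Kinv r * ·) (K_E_Kinv r)
  simpa [← mul_assoc, Kinv_mul_K] using h

lemma F_mul_Kinv (r : ℕ) : F r * Kinv r = (q r ^ 2)⁻¹ • (Kinv r * F r) := by
  have h := congrArg (Kinv r * ·) (K_F_Kinv r)
  simpa [← mul_assoc, Kinv_mul_K] using h

lemma Kinv_mul_E (r : ℕ) : Kinv r * E r = (q r ^ 2)⁻¹ • (E r * Kinv r) := by
  rw [E_mul_Kinv, smul_smul, inv_mul_cancel₀ (pow_ne_zero 2 (q_ne_zero r)), one_smul]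

lemma Kinv_mul_F (r : ℕ) : Kinv r * F r = q r ^ 2 • (F r * Kinv r) := by
  rw [F_mul_Kinv, smul_smul, mul_inv_cancel₀ (pow_ne_zero 2 (q_ne_zero r)), one_smul]

/-- Four elements of an algebra satisfying the relations of `u_q sl₂`. -/
structure IsRep (r : ℕ) {A : Type} [Ring A] [Algebra ℂ A] (k l e f : A) : Prop where
  kl : k * l = 1
  lk : l * k = 1
  ke : k * e = q r ^ 2 • (e * k)
  kf : k * f = (q r ^ 2)⁻¹ • (f * k)
  ef : e * f - f * e = (q r - (q r)⁻¹)⁻¹ • (k - l)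
  kp : k ^ r' r = 1
  ep : e ^ r' r = 0
  fp : f ^ r' r = 0

/-- The images of the generators. -/
def genMap {A : Type} (k l e f : A) : Gen → A
  | .K => k
  | .Kinv => l
  | .E => e
  | .F => f

/-- The universal property of `u_q sl₂`. -/
def lift (r : ℕ) {A : Type} [Ring A] [Algebra ℂ A] {k l e f : A} (h : IsRep r k l e f) :
    Uq r →ₐ[ℂ] A :=
  RingQuot.liftAlgHom ℂ ⟨FreeAlgebra.lift ℂ (genMap k l e f), by
    intro x y hxy
    cases hxy with
    | K_Kinv => simpa [genMap] using h.kl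
    | Kinv_K => simpa [genMap] using h.lk
    | K_E =>
      have h1 : k * e * l = q r ^ 2 • e := by rw [h.ke, smul_mul_assoc, mul_assoc, h.kl, mul_one]
      simpa [genMap] using h1
    | K_F =>
      have h1 : k * f * l = (q r ^ 2)⁻¹ • f := by
        rw [h.kf, smul_mul_assoc, mul_assoc, h.kl, mul_one]
      simpa [genMap] using h1
    | E_F => simpa [genMap] using h.ef
    | K_pow => simpa [genMap] using h.kp
    | E_pow => simpa [genMap] using h.ep
    | F_pow => simpa [genMap] using h.fp⟩

section lift

variable (r : ℕ) {A : Type} [Ring A] [Algebra ℂ A] {k l e f : A} (h : IsRep r k l e f)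

lemma lift_mk (x : FreeAlgebra ℂ Gen) :
    lift r h (mk r x) = FreeAlgebra.lift ℂ (genMap k l e f) x :=
  RingQuot.liftAlgHom_mkAlgHom_apply _ _ _ _

@[simp] lemma lift_K : lift r h (K r) = k := by simp [K, lift_mk, genMap]

@[simp] lemma lift_Kinv : lift r h (Kinv r) = l := by simp [Kinv, lift_mk, genMap]

@[simp] lemma lift_E : lift r h (E r) = e := by simp [E, lift_mk, genMap]

@[simp] lemma lift_F : lift r h (F r) = f := by simp [F, lift_mk, genMap]

end lift

lemma algHom_ext {r : ℕ} {A : Type} [Ring A] [Algebra ℂ A] {φ ψ : Uq r →ₐ[ℂ] A}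
    (hK : φ (K r) = ψ (K r)) (hKinv : φ (Kinv r) = ψ (Kinv r))
    (hE : φ (E r) = ψ (E r)) (hF : φ (F r) = ψ (F r)) : φ = ψ := by
  refine RingQuot.ringQuot_ext' (S := ℂ) φ ψ (FreeAlgebra.hom_ext (funext fun x => ?_))
  cases x with
  | K => exact hK
  | Kinv => exact hKinv
  | E => exact hE
  | F => exact hF

/-- Induction over `u_q sl₂`. -/
lemma induction_on {r : ℕ} {P : Uq r → Prop} (x : Uq r) (hc : ∀ c : ℂ, P (algebraMap ℂ _ c))
    (hK : P (K r)) (hKinv : P (Kinv r)) (hE : P (E r)) (hF : P (F r))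
    (hadd : ∀ a b, P a → P b → P (a + b)) (hmul : ∀ a b, P a → P b → P (a * b)) : P x := by
  obtain ⟨y, rfl⟩ := RingQuot.mkAlgHom_surjective ℂ (Rel r) x
  change P (mk r y)
  induction y using FreeAlgebra.induction with
  | grade0 c => rw [AlgHom.commutes]; exact hc c
  | grade1 x =>
    cases x with
    | K => exact hK
    | Kinv => exact hKinv
    | E => exact hE
    | F => exact hF
  | mul a b ha hb => rw [map_mul]; exact hmul _ _ ha hb
  | add a b ha hb => rw [map_add]; exact hadd _ _ ha hb

/-! ### Powers of `ω`-commuting elements -/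

/-- The Gaussian binomial coefficient of `i + j` over `i` at `ω`. -/
def gauss (ω : ℂ) : ℕ → ℕ → ℂ
  | 0, _ => 1
  | _ + 1, 0 => 1
  | i + 1, j + 1 => gauss ω i (j + 1) + ω ^ (i + 1) * gauss ω (i + 1) j

lemma gauss_zero_right (ω : ℂ) (i : ℕ) : gauss ω i 0 = 1 := by cases i <;> simp [gauss]

lemma gauss_zero_left (ω : ℂ) (j : ℕ) : gauss ω 0 j = 1 := by simp [gauss]

lemma gauss_succ_succ (ω : ℂ) (i j : ℕ) :
    gauss ω (i + 1) (j + 1) = gauss ω i (j + 1) + ω ^ (i + 1) * gauss ω (i + 1) j := by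
  rw [gauss]

lemma gauss_step (ω : ℂ) (n : ℕ) : ∀ i j : ℕ, i + j = n →
    (1 - ω ^ (i + 1)) * gauss ω (i + 1) j = (1 - ω ^ (i + j + 1)) * gauss ω i j ∧
    (1 - ω ^ (j + 1)) * gauss ω i (j + 1) = (1 - ω ^ (i + j + 1)) * gauss ω i j := by
  induction n with
  | zero =>
    intro i j h
    obtain ⟨rfl, rfl⟩ : i = 0 ∧ j = 0 := by omega
    simp [gauss_zero_left, gauss_zero_right]
  | succ n ih =>
    intro i j h
    constructor
    · cases j with
      | zero => simp [gauss_zero_right]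
      | succ j =>
        obtain ⟨hA, hB⟩ := ih i j (by omega)
        rw [gauss_succ_succ]
        have e1 : ω ^ (i + (j + 1) + 1) = ω ^ (i + 1) * ω ^ (j + 1) := by ring
        rw [e1]
        linear_combination ω ^ (i + 1) * hA - ω ^ (i + 1) * hB
    · cases i with
      | zero => simp [gauss_zero_left]
      | succ i =>
        obtain ⟨hA, hB⟩ := ih i j (by omega)
        rw [gauss_succ_succ]
        have e1 : ω ^ (i + 1 + j + 1) = ω ^ (i + 1) * ω ^ (j + 1) := by ring
        rw [e1]
        linear_combination hB - hA

section qcomm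

variable {A : Type} [Ring A] [Algebra ℂ A] {x y : A} {ω : ℂ}

lemma mul_pow_qcomm (h : y * x = ω • (x * y)) (n : ℕ) : y * x ^ n = ω ^ n • (x ^ n * y) := by
  induction n with
  | zero => simp
  | succ n ih =>
    rw [pow_succ, ← mul_assoc, ih, smul_mul_assoc, mul_assoc, h, mul_smul_comm, smul_smul,
      pow_succ, mul_assoc]

lemma add_pow_qcomm (h : y * x = ω • (x * y)) (n : ℕ) :
    (x + y) ^ n =
      ∑ p ∈ Finset.HasAntidiagonal.antidiagonal n, gauss ω p.1 p.2 • (x ^ p.1 * y ^ p.2) := by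
  induction n with
  | zero => simp [gauss_zero_left]
  | succ n ih =>
    have hx : ∀ i j : ℕ, x * (gauss ω i j • (x ^ i * y ^ j)) =
        gauss ω i j • (x ^ (i + 1) * y ^ j) := by
      intro i j
      rw [mul_smul_comm, ← mul_assoc, ← pow_succ']
    have hy : ∀ i j : ℕ, y * (gauss ω i j • (x ^ i * y ^ j)) =
        (ω ^ i * gauss ω i j) • (x ^ i * y ^ (j + 1)) := by
      intro i j
      rw [mul_smul_comm, ← mul_assoc, mul_pow_qcomm h, smul_mul_assoc, smul_smul, mul_assoc,
        ← pow_succ', mul_comm]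
    rw [pow_succ', ih, add_mul, Finset.mul_sum, Finset.mul_sum]
    simp only [hx, hy]
    let a : ℕ → ℕ → ℂ := fun i j => Nat.casesOn i 0 (fun i => gauss ω i j)
    let b : ℕ → ℕ → ℂ := fun i j => Nat.casesOn j 0 (fun j => ω ^ i * gauss ω i j)
    have hab : ∀ p ∈ Finset.HasAntidiagonal.antidiagonal (n + 1),
        gauss ω p.1 p.2 • (x ^ p.1 * y ^ p.2) =
          a p.1 p.2 • (x ^ p.1 * y ^ p.2) + b p.1 p.2 • (x ^ p.1 * y ^ p.2) := by
      rintro ⟨i, j⟩ hp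
      rw [Finset.HasAntidiagonal.mem_antidiagonal] at hp
      rw [← add_smul]
      congr 1
      rcases i with _ | i <;> rcases j with _ | j
      · simp at hp
      · simp [a, b, gauss_zero_left]
      · simp [a, b, gauss_zero_right]
      · simp [a, b, gauss_succ_succ]
    rw [Finset.sum_congr rfl hab, Finset.sum_add_distrib, Finset.Nat.sum_antidiagonal_succ,
      Finset.Nat.sum_antidiagonal_succ']
    simp [a, b]

lemma add_pow_eq_zero {n : ℕ} (hω : n ≠ 0 → IsPrimitiveRoot ω n) (h : y * x = ω • (x * y))
    (hx : x ^ n = 0) (hy : y ^ n = 0) : (x + y) ^ n = 0 := by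
  rw [add_pow_qcomm h]
  refine Finset.sum_eq_zero fun p hp => ?_
  obtain ⟨i, j⟩ := p
  rw [Finset.HasAntidiagonal.mem_antidiagonal] at hp
  simp only at hp ⊢
  rcases Nat.eq_zero_or_pos i with rfl | hi
  · obtain rfl : j = n := by omega
    simp [hy]
  rcases Nat.eq_zero_or_pos j with rfl | hj
  · obtain rfl : i = n := by omega
    simp [hx]
  obtain ⟨i, rfl⟩ : ∃ m, i = m + 1 := ⟨i - 1, by omega⟩
  have hr := hω (by omega)
  have hA := (gauss_step ω (i + j) i j rfl).1
  have e : i + j + 1 = n := by omega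
  rw [e, hr.pow_eq_one, sub_self, zero_mul] at hA
  have hne : (1 : ℂ) - ω ^ (i + 1) ≠ 0 :=
    sub_ne_zero.2 (hr.pow_ne_one_of_pos_of_lt (by omega) (by omega)).symm
  rw [(mul_eq_zero.1 hA).resolve_left hne, zero_smul]

lemma mul_pow_eq_zero (h : y * x = ω • (x * y)) {n : ℕ} (hx : x ^ n = 0) :
    (x * y) ^ n = 0 := by
  have key : ∀ m : ℕ, ∃ c : ℂ, (x * y) ^ m = c • (x ^ m * y ^ m) := by
    intro m
    induction m with
    | zero => exact ⟨1, by simp⟩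
    | succ m ih =>
      obtain ⟨c, hc⟩ := ih
      refine ⟨c * ω ^ m, ?_⟩
      rw [pow_succ', hc, mul_smul_comm, mul_assoc, ← mul_assoc y, mul_pow_qcomm h,
        smul_mul_assoc, mul_smul_comm, smul_smul, mul_assoc (x ^ m), ← pow_succ', ← mul_assoc,
        ← pow_succ']
  obtain ⟨c, hc⟩ := key n
  rw [hc, hx, zero_mul, smul_zero]

end qcomm

lemma isPrimitiveRoot_of_r'_ne_zero {r : ℕ} (h : r' r ≠ 0) :
    IsPrimitiveRoot (q r ^ 2) (r' r) := by
  refine isPrimitiveRoot_q_sq ?_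
  rintro rfl
  exact h (by simp [r'])

/-! ### The Hopf algebra structure -/

lemma isRep_comul (r : ℕ) : IsRep r (A := Uq r ⊗[ℂ] Uq r)
    (K r ⊗ₜ K r) (Kinv r ⊗ₜ Kinv r) (E r ⊗ₜ K r + 1 ⊗ₜ E r) (F r ⊗ₜ 1 + Kinv r ⊗ₜ F r) where
  kl := by simp [K_mul_Kinv, Algebra.TensorProduct.one_def]
  lk := by simp [Kinv_mul_K, Algebra.TensorProduct.one_def]
  ke := by
    simp [mul_add, add_mul, K_mul_E, TensorProduct.smul_tmul', TensorProduct.tmul_smul]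
  kf := by
    simp [mul_add, add_mul, K_mul_F, TensorProduct.smul_tmul', TensorProduct.tmul_smul,
      K_mul_Kinv, Kinv_mul_K]
  ef := by
    have h := E_F_comm r
    rw [sub_eq_iff_eq_add] at h
    simp only [mul_add, add_mul, Algebra.TensorProduct.tmul_mul_tmul, one_mul, mul_one, h,
      E_mul_Kinv, K_mul_F, TensorProduct.add_tmul, TensorProduct.tmul_add,
      TensorProduct.smul_tmul', TensorProduct.tmul_smul, smul_smul, TensorProduct.sub_tmul,
      TensorProduct.tmul_sub, smul_sub]
    rw [inv_mul_cancel₀ (pow_ne_zero 2 (q_ne_zero r)), one_smul]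
    abel
  kp := by
    rw [Algebra.TensorProduct.tmul_pow, K_pow, Algebra.TensorProduct.one_def]
  ep := by
    rw [add_comm]
    refine add_pow_eq_zero (ω := q r ^ 2) isPrimitiveRoot_of_r'_ne_zero ?_ ?_ ?_
    · simp [K_mul_E]
    · rw [Algebra.TensorProduct.tmul_pow, E_pow, TensorProduct.tmul_zero]
    · rw [Algebra.TensorProduct.tmul_pow, E_pow, TensorProduct.zero_tmul]
  fp := by
    refine add_pow_eq_zero (ω := q r ^ 2) isPrimitiveRoot_of_r'_ne_zero ?_ ?_ ?_
    · simp [Kinv_mul_F, TensorProduct.smul_tmul']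
    · rw [Algebra.TensorProduct.tmul_pow, F_pow, TensorProduct.zero_tmul]
    · rw [Algebra.TensorProduct.tmul_pow, F_pow, TensorProduct.tmul_zero]

/-- The coproduct: `ΔK = K ⊗ K`, `ΔE = E ⊗ K + 1 ⊗ E`, `ΔF = F ⊗ 1 + K⁻¹ ⊗ F`. -/
def comulHom (r : ℕ) : Uq r →ₐ[ℂ] Uq r ⊗[ℂ] Uq r := lift r (isRep_comul r)

lemma r'_eq_zero {r : ℕ} (h : r' r = 0) : r = 0 := by
  by_contra hr
  have h1 : Nat.gcd r 2 ≤ r := Nat.gcd_le_left 2 (Nat.pos_of_ne_zero hr)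
  have h2 : 0 < Nat.gcd r 2 := Nat.gcd_pos_of_pos_left 2 (Nat.pos_of_ne_zero hr)
  have := Nat.div_pos h1 h2
  rw [r'] at h
  omega

lemma isRep_counit {r : ℕ} (hr : r ≠ 0) : IsRep r (A := ℂ) 1 1 0 0 where
  kl := by simp
  lk := by simp
  ke := by simp
  kf := by simp
  ef := by simp
  kp := by simp
  ep := zero_pow (fun h => hr (r'_eq_zero h))
  fp := zero_pow (fun h => hr (r'_eq_zero h))

/-- The counit: `ε(K) = 1`, `ε(E) = ε(F) = 0`. -/
def counitHom (r : ℕ) [NeZero r] : Uq r →ₐ[ℂ] ℂ := lift r (isRep_counit (NeZero.ne r))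

lemma isRep_antipode (r : ℕ) : IsRep r (A := (Uq r)ᵐᵒᵖ)
    (MulOpposite.op (Kinv r)) (MulOpposite.op (K r))
    (MulOpposite.op (-(E r * Kinv r))) (MulOpposite.op (-(K r * F r))) where
  kl := by rw [← MulOpposite.op_mul, K_mul_Kinv, MulOpposite.op_one]
  lk := by rw [← MulOpposite.op_mul, Kinv_mul_K, MulOpposite.op_one]
  ke := by
    rw [← MulOpposite.op_mul, ← MulOpposite.op_mul, ← MulOpposite.op_smul]
    congr 1
    rw [mul_neg, ← mul_assoc, neg_mul, E_mul_Kinv, smul_mul_assoc, smul_neg]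
  kf := by
    rw [← MulOpposite.op_mul, ← MulOpposite.op_mul, ← MulOpposite.op_smul]
    congr 1
    rw [mul_neg, ← mul_assoc, neg_mul, Kinv_mul_K, one_mul, K_mul_F, smul_mul_assoc, mul_assoc,
      K_mul_Kinv, mul_one, smul_neg]
  ef := by
    rw [← MulOpposite.op_mul, ← MulOpposite.op_mul, ← MulOpposite.op_sub, ← MulOpposite.op_sub,
      ← MulOpposite.op_smul]
    congr 1
    have h := E_F_comm r
    have h1 : -(K r * F r) * -(E r * Kinv r) = F r * E r := by
      rw [neg_mul_neg, K_mul_F, E_mul_Kinv, smul_mul_smul_comm,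
        inv_mul_cancel₀ (pow_ne_zero 2 (q_ne_zero r)), one_smul, mul_assoc, ← mul_assoc (K r),
        K_mul_Kinv, one_mul]
    have h2 : -(E r * Kinv r) * -(K r * F r) = E r * F r := by
      rw [neg_mul_neg, mul_assoc, ← mul_assoc (Kinv r), Kinv_mul_K, one_mul]
    rw [h1, h2, ← neg_sub, h, ← smul_neg, neg_sub]
  kp := by rw [← MulOpposite.op_pow, Kinv_pow, MulOpposite.op_one]
  ep := by
    rw [← MulOpposite.op_pow, neg_pow, mul_pow_eq_zero (Kinv_mul_E r) (E_pow r), mul_zero,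
      MulOpposite.op_zero]
  fp := by
    rw [← MulOpposite.op_pow, neg_pow, K_mul_F, smul_pow,
      mul_pow_eq_zero (K_mul_F r) (F_pow r), smul_zero, mul_zero, MulOpposite.op_zero]

/-- The antipode as an anti-homomorphism: `S(K) = K⁻¹`, `S(E) = -E K⁻¹`, `S(F) = -K F`. -/
def antipodeHom (r : ℕ) : Uq r →ₐ[ℂ] (Uq r)ᵐᵒᵖ := lift r (isRep_antipode r)

/-- The antipode as a linear map. -/
def antipodeLin (r : ℕ) : Uq r →ₗ[ℂ] Uq r :=
  (MulOpposite.opLinearEquiv ℂ).symm.toLinearMap ∘ₗ (antipodeHom r).toLinearMap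

lemma antipodeLin_mul (r : ℕ) (x y : Uq r) :
    antipodeLin r (x * y) = antipodeLin r y * antipodeLin r x := by
  simp [antipodeLin]

lemma antipodeLin_algebraMap (r : ℕ) (c : ℂ) :
    antipodeLin r (algebraMap ℂ _ c) = algebraMap ℂ _ c := by
  simp [antipodeLin, AlgHom.commutes, MulOpposite.algebraMap_apply]

lemma antipodeLin_one (r : ℕ) : antipodeLin r 1 = 1 := by
  simp [antipodeLin]

lemma antipodeLin_K (r : ℕ) : antipodeLin r (K r) = Kinv r := by
  simp [antipodeLin, antipodeHom]

lemma antipodeLin_Kinv (r : ℕ) : antipodeLin r (Kinv r) = K r := by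
  simp [antipodeLin, antipodeHom]

lemma antipodeLin_E (r : ℕ) : antipodeLin r (E r) = -(E r * Kinv r) := by
  simp [antipodeLin, antipodeHom]

lemma antipodeLin_F (r : ℕ) : antipodeLin r (F r) = -(K r * F r) := by
  simp [antipodeLin, antipodeHom]

instance instBialgebra (r : ℕ) [NeZero r] : Bialgebra ℂ (Uq r) :=
  Bialgebra.ofAlgHom (comulHom r) (counitHom r)
    (by
      apply algHom_ext <;>
        simp [comulHom, TensorProduct.add_tmul, TensorProduct.tmul_add,
          Algebra.TensorProduct.one_def, add_assoc])
    (by apply algHom_ext <;> simp [comulHom, counitHom])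
    (by apply algHom_ext <;> simp [comulHom, counitHom])

lemma comul_eq (r : ℕ) [NeZero r] (x : Uq r) : Coalgebra.comul (R := ℂ) x = comulHom r x := rfl

lemma counit_eq (r : ℕ) [NeZero r] (x : Uq r) : Coalgebra.counit (R := ℂ) x = counitHom r x := rfl

/-- The map `x ⊗ y ↦ S(x) z y`. -/
def leftConv (r : ℕ) (z : Uq r) : Uq r ⊗[ℂ] Uq r →ₗ[ℂ] Uq r :=
  LinearMap.mul' ℂ (Uq r) ∘ₗ
    TensorProduct.map (LinearMap.mulRight ℂ z ∘ₗ antipodeLin r) LinearMap.id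

/-- The map `x ⊗ y ↦ x z S(y)`. -/
def rightConv (r : ℕ) (z : Uq r) : Uq r ⊗[ℂ] Uq r →ₗ[ℂ] Uq r :=
  LinearMap.mul' ℂ (Uq r) ∘ₗ
    TensorProduct.map (LinearMap.mulRight ℂ z) (antipodeLin r)

lemma leftConv_mul (r : ℕ) (z : Uq r) (s t : Uq r ⊗[ℂ] Uq r) :
    leftConv r z (s * t) = leftConv r (leftConv r z s) t := by
  induction t using TensorProduct.induction_on with
  | zero => simp
  | add t1 t2 h1 h2 => rw [mul_add, map_add, map_add, h1, h2]
  | tmul a b =>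
    induction s using TensorProduct.induction_on with
    | zero => simp [leftConv]
    | add s1 s2 h1 h2 =>
      rw [add_mul, map_add, map_add, h1, h2]
      simp [leftConv, mul_add, add_mul]
    | tmul c d => simp [leftConv, antipodeLin_mul, mul_assoc]

lemma rightConv_mul (r : ℕ) (z : Uq r) (s t : Uq r ⊗[ℂ] Uq r) :
    rightConv r z (s * t) = rightConv r (rightConv r z t) s := by
  induction s using TensorProduct.induction_on with
  | zero => simp
  | add t1 t2 h1 h2 => rw [add_mul, map_add, map_add, h1, h2]
  | tmul a b =>
    induction t using TensorProduct.induction_on with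
    | zero => simp [rightConv]
    | add s1 s2 h1 h2 =>
      rw [mul_add, map_add, map_add, h1, h2]
      simp [rightConv, mul_add, add_mul]
    | tmul c d => simp [rightConv, antipodeLin_mul, mul_assoc]

lemma leftConv_smul (r : ℕ) (c : ℂ) (t : Uq r ⊗[ℂ] Uq r) :
    leftConv r (algebraMap ℂ _ c) t = c • leftConv r 1 t := by
  induction t using TensorProduct.induction_on with
  | zero => simp
  | add t1 t2 h1 h2 => rw [map_add, map_add, h1, h2, smul_add]
  | tmul a b => simp [leftConv, Algebra.algebraMap_eq_smul_one]

lemma rightConv_smul (r : ℕ) (c : ℂ) (t : Uq r ⊗[ℂ] Uq r) :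
    rightConv r (algebraMap ℂ _ c) t = c • rightConv r 1 t := by
  induction t using TensorProduct.induction_on with
  | zero => simp
  | add t1 t2 h1 h2 => rw [map_add, map_add, h1, h2, smul_add]
  | tmul a b => simp [rightConv, Algebra.algebraMap_eq_smul_one]

lemma leftConv_comul (r : ℕ) [NeZero r] (x : Uq r) :
    leftConv r 1 (comulHom r x) = algebraMap ℂ _ (counitHom r x) := by
  induction x using induction_on with
  | hc c =>
    rw [AlgHom.commutes, AlgHom.commutes, Algebra.algebraMap_eq_smul_one, map_smul,
      Algebra.TensorProduct.one_def]
    simp [leftConv, antipodeLin_one, Algebra.algebraMap_eq_smul_one]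
  | hK => simp [leftConv, comulHom, counitHom, antipodeLin_K, Kinv_mul_K]
  | hKinv => simp [leftConv, comulHom, counitHom, antipodeLin_Kinv, K_mul_Kinv]
  | hE =>
    simp [leftConv, comulHom, counitHom, antipodeLin_E, antipodeLin_one, mul_assoc, Kinv_mul_K]
  | hF => simp [leftConv, comulHom, counitHom, antipodeLin_F, antipodeLin_Kinv]
  | hadd a b ha hb => rw [map_add, map_add, ha, hb, map_add, map_add]
  | hmul a b ha hb =>
    rw [map_mul, leftConv_mul, ha, leftConv_smul, hb, map_mul, map_mul, Algebra.smul_def]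

lemma rightConv_comul (r : ℕ) [NeZero r] (x : Uq r) :
    rightConv r 1 (comulHom r x) = algebraMap ℂ _ (counitHom r x) := by
  induction x using induction_on with
  | hc c =>
    rw [AlgHom.commutes, AlgHom.commutes, Algebra.algebraMap_eq_smul_one, map_smul,
      Algebra.TensorProduct.one_def]
    simp [rightConv, antipodeLin_one, Algebra.algebraMap_eq_smul_one]
  | hK => simp [rightConv, comulHom, counitHom, antipodeLin_K, K_mul_Kinv]
  | hKinv => simp [rightConv, comulHom, counitHom, antipodeLin_Kinv, Kinv_mul_K]
  | hE => simp [rightConv, comulHom, counitHom, antipodeLin_E, antipodeLin_K]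
  | hF =>
    simp [rightConv, comulHom, counitHom, antipodeLin_F, antipodeLin_one, ← mul_assoc,
      Kinv_mul_K]
  | hadd a b ha hb => rw [map_add, map_add, ha, hb, map_add, map_add]
  | hmul a b ha hb =>
    rw [map_mul, rightConv_mul, hb, rightConv_smul, ha, map_mul, map_mul,
      Algebra.smul_def, Algebra.commutes]

/-- The Hopf algebra structure on `u_q sl₂`. -/
instance instHopfAlgebra (r : ℕ) [NeZero r] : HopfAlgebra ℂ (Uq r) where
  antipode := antipodeLin r
  mul_antipode_rTensor_comul := by
    ext x
    have h := leftConv_comul r x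
    have h1 : leftConv r 1 = LinearMap.mul' ℂ (Uq r) ∘ₗ (antipodeLin r).rTensor (Uq r) := by
      rw [leftConv, LinearMap.mulRight_one]; rfl
    rw [h1] at h
    exact h
  mul_antipode_lTensor_comul := by
    ext x
    have h := rightConv_comul r x
    have h1 : rightConv r 1 = LinearMap.mul' ℂ (Uq r) ∘ₗ (antipodeLin r).lTensor (Uq r) := by
      rw [rightConv, LinearMap.mulRight_one]; rfl
    rw [h1] at h
    exact h

/-! ### Integrals, R-matrix and ribbon element -/

/-- A left integral of a Hopf algebra `H`: a linear form with `λ(x₍₂₎) x₍₁₎ = λ(x) 1`. -/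
def IsLeftIntegral {H : Type} [Ring H] [HopfAlgebra ℂ H] (lam : H →ₗ[ℂ] ℂ) : Prop :=
  ∀ x : H, TensorProduct.rid ℂ H (lam.lTensor H (Coalgebra.comul x)) = lam x • (1 : H)

/-- The Drinfeld element `u = S(R'') R'` of `R = R' ⊗ R''`. -/
def drinfeldElement {H : Type} [Ring H] [HopfAlgebra ℂ H] (R : H ⊗[ℂ] H) : H :=
  LinearMap.mul' ℂ H ((HopfAlgebra.antipode ℂ (A := H)).rTensor H (TensorProduct.comm ℂ H H R))

/-- The R-matrix of `u_q sl₂`. -/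
def RMatrix (r : ℕ) : Uq r ⊗[ℂ] Uq r :=
  (1 / (r' r : ℂ)) •
    ∑ a ∈ Finset.range (r' r), ∑ b ∈ Finset.range (r' r), ∑ c ∈ Finset.range (r' r),
      (qBrace r 1 ^ a / qFact r a * q r ^ (((a * (a - 1) / 2 : ℕ) : ℤ) - 2 * b * c)) •
        ((K r ^ b * E r ^ a) ⊗ₜ[ℂ] (K r ^ c * F r ^ a))

/-- The ribbon element `v₊ = u g⁻¹` with pivotal element `g = K`. -/
def ribbonElement (r : ℕ) [NeZero r] : Uq r :=
  drinfeldElement (RMatrix r) * Kinv r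

/-- The value of the preferred integral on the monomials `E^a F^b K^c`, `0 ≤ a, b, c ≤ r' - 1`. -/
def IsPreferred (r : ℕ) (lam : Uq r →ₗ[ℂ] ℂ) : Prop :=
  ∀ a b c : ℕ, a < r' r → b < r' r → c < r' r →
    lam (E r ^ a * F r ^ b * K r ^ c) =
      if a = r' r - 1 ∧ b = r' r - 1 ∧ c = r' r - 1 then
        (Real.sqrt (r'' r) : ℂ) * qFact r (r' r - 1) / qBrace r 1 ^ (r' r - 1)
      else 0

end

end SmallQuantum

namespace SmallQuantum

noncomputable section

/-! The monomials `E^i F^j K^c` span the algebra, so a preferred form is unique. Existence would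
normally follow from their linear independence (PBW); here the form is built directly. Convolving a
matrix coefficient of a lowest weight module with one of a highest weight module of weight `ν` gives
a form supported on the monomials of top degree in `E` and `F`, proportional to `ν^c` there
(`weightForm_monomial`). A Fourier sum over the `r'`-th roots of unity `ν` then isolates `c = r' -
1`. The integral property is read off from the coproduct of a monomial: the form on the second
factor leaves at most one term.

For the ribbon element, filter by the degree in `E`. Reordering `F^a E^a` into `E^a F^a` costs only
lower terms, which the form kills, so only `a = r' - 1` survives in the R-matrix. The power of `K`
then forces `b ≡ c + 1`, and the triple sum collapses to a multiple of the Gauss sum of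
`q^(-2c(c+1))` over `c` modulo `r'` (`IsPreferred.apply_ribbonElement`).

When `r` is not divisible by 8 the sum is reduced to one over triangular exponents at a primitive
root `ω` of odd order `n = 2p + 1`. Gauss's identity for alternating sums of Gaussian binomials
turns that into the product of `1 - ω^(2k+1)` for `k < p` (`sum_inv_pow_triangular`). Its modulus is
the square root of `n`, because the missing factors are the complex conjugates; its phase comes from
half-angle formulas with positive sines or cosines. When 8 divides `r`, translation by `r'/2`
reverses the sign of every term and the sum vanishes. -/

/-! ### Commutation rules and the filtration by degree in `E`. -/

lemma r'_ne_zero (r : ℕ) [NeZero r] : r' r ≠ 0 := fun h => NeZero.ne r (r'_eq_zero h)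

lemma r'_pos (r : ℕ) [NeZero r] : 0 < r' r := Nat.pos_of_ne_zero (r'_ne_zero r)

lemma Kinv_eq_pow (r : ℕ) [NeZero r] : Kinv r = K r ^ (r' r - 1) := by
  have h : K r * K r ^ (r' r - 1) = 1 := by
    rw [← pow_succ', Nat.sub_add_cancel (r'_pos r), K_pow]
  calc Kinv r = Kinv r * (K r * K r ^ (r' r - 1)) := by rw [h, mul_one]
    _ = K r ^ (r' r - 1) := by rw [← mul_assoc, Kinv_mul_K, one_mul]

lemma K_pow_mod (r n : ℕ) : K r ^ n = K r ^ (n % r' r) := by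
  conv_lhs => rw [← Nat.div_add_mod n (r' r), pow_add, pow_mul, K_pow, one_pow, one_mul]

lemma K_pow_mul_E (r n : ℕ) : K r ^ n * E r = (q r ^ 2) ^ n • (E r * K r ^ n) := by
  induction n with
  | zero => simp
  | succ n ih =>
    rw [pow_succ, mul_assoc, K_mul_E, mul_smul_comm, ← mul_assoc, ih, smul_mul_assoc, smul_smul,
      mul_assoc, ← pow_succ']

lemma K_pow_mul_F (r n : ℕ) : K r ^ n * F r = ((q r ^ 2)⁻¹) ^ n • (F r * K r ^ n) := by
  induction n with
  | zero => simp
  | succ n ih =>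
    rw [pow_succ, mul_assoc, K_mul_F, mul_smul_comm, ← mul_assoc, ih, smul_mul_assoc, smul_smul,
      mul_assoc, ← pow_succ']

lemma K_pow_mul_E_pow (r n m : ℕ) :
    K r ^ n * E r ^ m = ((q r ^ 2) ^ n) ^ m • (E r ^ m * K r ^ n) :=
  mul_pow_qcomm (K_pow_mul_E r n) m

lemma K_pow_mul_F_pow (r n m : ℕ) :
    K r ^ n * F r ^ m = (((q r ^ 2)⁻¹) ^ n) ^ m • (F r ^ m * K r ^ n) :=
  mul_pow_qcomm (K_pow_mul_F r n) m

/-- The coefficients are left unspecified: all that matters later is that the correction term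
contains no `E`. -/
lemma F_pow_succ_mul_E (r n : ℕ) : ∃ c d : ℂ,
    F r ^ (n + 1) * E r = E r * F r ^ (n + 1) + F r ^ n * (c • K r + d • Kinv r) := by
  have h : F r * E r = E r * F r - (q r - (q r)⁻¹)⁻¹ • (K r - Kinv r) := by
    rw [← E_F_comm]; abel
  induction n with
  | zero =>
    refine ⟨-(q r - (q r)⁻¹)⁻¹, (q r - (q r)⁻¹)⁻¹, ?_⟩
    rw [zero_add, pow_one, h, pow_zero, one_mul]
    module
  | succ n ih =>
    obtain ⟨c, d, ih⟩ := ih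
    refine ⟨c * (q r ^ 2)⁻¹ - (q r - (q r)⁻¹)⁻¹, d * q r ^ 2 + (q r - (q r)⁻¹)⁻¹, ?_⟩
    have h2 : F r ^ n * (c • K r + d • Kinv r) * F r =
        F r ^ (n + 1) * ((c * (q r ^ 2)⁻¹) • K r + (d * q r ^ 2) • Kinv r) := by
      rw [mul_assoc, add_mul, smul_mul_assoc, smul_mul_assoc, K_mul_F, Kinv_mul_F, smul_smul,
        smul_smul, pow_succ (F r), mul_assoc, mul_add (F r), mul_smul_comm, mul_smul_comm]
    rw [pow_succ, mul_assoc, h, mul_sub, ← mul_assoc, ih, add_mul, mul_assoc, ← pow_succ, h2,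
      add_sub_assoc, ← mul_sub]
    congr 2
    module

/-- The span of the monomials `E^i F^j K^c` with `i < n`. -/
def monomialSpan (r n : ℕ) : Submodule ℂ (Uq r) :=
  Submodule.span ℂ {x | ∃ i j c : ℕ, i < n ∧ x = E r ^ i * F r ^ j * K r ^ c}

lemma monomial_mem {r n i : ℕ} (h : i < n) (j c : ℕ) :
    E r ^ i * F r ^ j * K r ^ c ∈ monomialSpan r n :=
  Submodule.subset_span ⟨i, j, c, h, rfl⟩

lemma monomialSpan_mono {r n m : ℕ} (h : n ≤ m) : monomialSpan r n ≤ monomialSpan r m := by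
  refine Submodule.span_mono ?_
  rintro _ ⟨i, j, c, hi, rfl⟩
  exact ⟨i, j, c, by omega, rfl⟩

lemma mul_mem_monomialSpan {r n m : ℕ} {y : Uq r}
    (h : ∀ i j c : ℕ, i < n → E r ^ i * F r ^ j * K r ^ c * y ∈ monomialSpan r m)
    {x : Uq r} (hx : x ∈ monomialSpan r n) : x * y ∈ monomialSpan r m := by
  have : monomialSpan r n ≤ (monomialSpan r m).comap (LinearMap.mulRight ℂ y) := by
    refine Submodule.span_le.2 ?_
    rintro _ ⟨i, j, c, hi, rfl⟩
    exact h i j c hi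
  exact this hx

lemma mul_K_mem {r n : ℕ} {x : Uq r} (hx : x ∈ monomialSpan r n) :
    x * K r ∈ monomialSpan r n :=
  mul_mem_monomialSpan (fun i j c hi => by
    rw [mul_assoc, ← pow_succ]; exact monomial_mem hi _ _) hx

lemma mul_K_pow_mem {r n : ℕ} {x : Uq r} (hx : x ∈ monomialSpan r n) (m : ℕ) :
    x * K r ^ m ∈ monomialSpan r n := by
  induction m with
  | zero => simpa using hx
  | succ m ih => rw [pow_succ, ← mul_assoc]; exact mul_K_mem ih

lemma mul_Kinv_mem {r n : ℕ} [NeZero r] {x : Uq r} (hx : x ∈ monomialSpan r n) :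
    x * Kinv r ∈ monomialSpan r n := by
  rw [Kinv_eq_pow]; exact mul_K_pow_mem hx _

lemma mul_F_mem {r n : ℕ} {x : Uq r} (hx : x ∈ monomialSpan r n) :
    x * F r ∈ monomialSpan r n :=
  mul_mem_monomialSpan (fun i j c hi => by
    rw [mul_assoc, K_pow_mul_F, mul_smul_comm, ← mul_assoc, mul_assoc (E r ^ i), ← pow_succ]
    exact Submodule.smul_mem _ _ (monomial_mem hi _ _)) hx

/-- Moving `E` to the left past `F^j` produces corrections in `F` and `K` only, so the degree in `E`
of the error stays at `i`. -/
lemma monomial_mul_E_sub_mem {r n i : ℕ} [NeZero r] (hi : i < n) (j : ℕ) :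
    E r ^ i * F r ^ j * E r - E r ^ (i + 1) * F r ^ j ∈ monomialSpan r n := by
  cases j with
  | zero => simp [pow_succ]
  | succ j =>
    obtain ⟨c, d, h⟩ := F_pow_succ_mul_E r j
    rw [mul_assoc, h, mul_add, ← mul_assoc, ← pow_succ, add_sub_cancel_left, ← mul_assoc, mul_add,
      mul_smul_comm, mul_smul_comm]
    have h0 : E r ^ i * F r ^ j ∈ monomialSpan r n := by
      simpa using monomial_mem hi j 0
    exact add_mem (Submodule.smul_mem _ _ (mul_K_mem h0)) (Submodule.smul_mem _ _ (mul_Kinv_mem h0))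

lemma mul_E_mem {r n : ℕ} [NeZero r] {x : Uq r} (hx : x ∈ monomialSpan r n) :
    x * E r ∈ monomialSpan r (n + 1) :=
  mul_mem_monomialSpan (fun i j c hi => by
    rw [mul_assoc, K_pow_mul_E, mul_smul_comm, ← mul_assoc]
    refine Submodule.smul_mem _ _ (mul_K_pow_mem ?_ c)
    have h1 := monomialSpan_mono n.le_succ (monomial_mul_E_sub_mem (r := r) hi j)
    have h2 : E r ^ (i + 1) * F r ^ j ∈ monomialSpan r (n + 1) := by
      simpa using monomial_mem (Nat.succ_lt_succ hi) j 0
    simpa using add_mem h1 h2) hx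

/-- `F^m` and `E^n` commute modulo lower degree in `E`. The ribbon element is a sum of terms with
`F` on the left, and this is the only reordering its evaluation needs. -/
lemma F_pow_mul_E_pow_sub_mem (r m n : ℕ) [NeZero r] :
    F r ^ m * E r ^ n - E r ^ n * F r ^ m ∈ monomialSpan r n := by
  induction n with
  | zero => simp
  | succ n ih =>
    have h1 := mul_E_mem ih
    have h2 := monomial_mul_E_sub_mem (r := r) n.lt_succ_self m
    have h := add_mem h1 h2
    rwa [sub_mul, mul_assoc, ← pow_succ, sub_add_sub_cancel] at h

/-- The span contains 1 and is stable under right multiplication by each generator; for `E` the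
possible overflow in degree vanishes because `E^r' = 0`. -/
lemma monomialSpan_eq_top (r : ℕ) [NeZero r] : monomialSpan r (r' r) = ⊤ := by
  have hE : ∀ x ∈ monomialSpan r (r' r), x * E r ∈ monomialSpan r (r' r) := by
    intro x hx
    have hle : monomialSpan r (r' r + 1) ≤ monomialSpan r (r' r) := by
      refine Submodule.span_le.2 ?_
      rintro _ ⟨i, j, c, hi, rfl⟩
      rcases Nat.lt_succ_iff_lt_or_eq.1 hi with hi | rfl
      · exact monomial_mem hi j c
      · simp [E_pow]
    exact hle (mul_E_mem hx)
  have key : ∀ y : Uq r, ∀ x ∈ monomialSpan r (r' r), x * y ∈ monomialSpan r (r' r) := by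
    intro y
    induction y using induction_on with
    | hc c =>
      intro x hx
      rw [← Algebra.commutes, ← Algebra.smul_def]
      exact Submodule.smul_mem _ _ hx
    | hK => exact fun x hx => mul_K_mem hx
    | hKinv => exact fun x hx => mul_Kinv_mem hx
    | hE => exact hE
    | hF => exact fun x hx => mul_F_mem hx
    | hadd a b ha hb => exact fun x hx => by rw [mul_add]; exact add_mem (ha x hx) (hb x hx)
    | hmul a b ha hb => exact fun x hx => by rw [← mul_assoc]; exact hb _ (ha x hx)
  refine Submodule.eq_top_iff'.2 fun y => ?_
  have h1 : (1 : Uq r) ∈ monomialSpan r (r' r) := by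
    simpa using monomial_mem (r'_pos r) 0 0 (r := r)
  simpa using key y 1 h1

/-! ### Values of a preferred form and its uniqueness. -/

/-- The value of the preferred integral on the monomial of top degree. -/
def topValue (r : ℕ) : ℂ :=
  (Real.sqrt (r'' r) : ℂ) * qFact r (r' r - 1) / qBrace r 1 ^ (r' r - 1)

lemma IsPreferred.apply_monomial {r : ℕ} [NeZero r] {lam : Uq r →ₗ[ℂ] ℂ} (h : IsPreferred r lam)
    (i j c : ℕ) : lam (E r ^ i * F r ^ j * K r ^ c) =
      if i = r' r - 1 ∧ j = r' r - 1 ∧ c % r' r = r' r - 1 then topValue r else 0 := by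
  have hN := r'_pos r
  by_cases hi : i < r' r
  · by_cases hj : j < r' r
    · rw [K_pow_mod, h i j _ hi hj (Nat.mod_lt _ hN), topValue]
    · rw [pow_eq_zero_of_le (not_lt.1 hj) (F_pow r), if_neg (by omega)]; simp
  · rw [pow_eq_zero_of_le (not_lt.1 hi) (E_pow r), if_neg (by omega)]; simp

lemma IsPreferred.apply_eq_zero {r : ℕ} [NeZero r] {lam : Uq r →ₗ[ℂ] ℂ} (h : IsPreferred r lam)
    {x : Uq r} (hx : x ∈ monomialSpan r (r' r - 1)) : lam x = 0 := by
  have : monomialSpan r (r' r - 1) ≤ LinearMap.ker lam := by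
    refine Submodule.span_le.2 ?_
    rintro _ ⟨i, j, c, hi, rfl⟩
    simp only [SetLike.mem_coe, LinearMap.mem_ker]
    rw [h.apply_monomial, if_neg (by omega)]
  exact this hx

lemma linearMap_ext_monomial {r : ℕ} [NeZero r] {M : Type} [AddCommGroup M] [Module ℂ M]
    {f g : Uq r →ₗ[ℂ] M}
    (h : ∀ i j c : ℕ, f (E r ^ i * F r ^ j * K r ^ c) = g (E r ^ i * F r ^ j * K r ^ c)) :
    f = g := by
  refine LinearMap.ext_on (monomialSpan_eq_top r) ?_
  rintro _ ⟨i, j, c, -, rfl⟩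
  exact h i j c

lemma IsPreferred.unique {r : ℕ} [NeZero r] {lam mu : Uq r →ₗ[ℂ] ℂ} (h : IsPreferred r lam)
    (h' : IsPreferred r mu) : lam = mu :=
  linearMap_ext_monomial fun i j c => by rw [h.apply_monomial, h'.apply_monomial]

/-! ### The coproduct of a monomial -/

lemma comulHom_E_pow (r n : ℕ) : comulHom r (E r ^ n) =
    ∑ p ∈ Finset.HasAntidiagonal.antidiagonal n,
      gauss (q r ^ 2) p.1 p.2 • ((E r ^ p.2) ⊗ₜ[ℂ] (E r ^ p.1 * K r ^ p.2)) := by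
  -- The swap puts `1 ⊗ E` first, since `(E ⊗ K)(1 ⊗ E)` is `q²` times the product in the other
  -- order.
  rw [map_pow, comulHom, lift_E, add_comm, add_pow_qcomm (ω := q r ^ 2)]
  · simp [Algebra.TensorProduct.tmul_pow]
  · simp [K_mul_E]

lemma comulHom_F_pow (r n : ℕ) : comulHom r (F r ^ n) =
    ∑ p ∈ Finset.HasAntidiagonal.antidiagonal n,
      gauss (q r ^ 2) p.1 p.2 • ((F r ^ p.1 * Kinv r ^ p.2) ⊗ₜ[ℂ] (F r ^ p.2)) := by
  rw [map_pow, comulHom, lift_F, add_pow_qcomm (ω := q r ^ 2)]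
  · simp [Algebra.TensorProduct.tmul_pow, Algebra.TensorProduct.tmul_mul_tmul]
  · simp [Kinv_mul_F, TensorProduct.smul_tmul']

lemma comulHom_K_pow (r n : ℕ) : comulHom r (K r ^ n) = (K r ^ n) ⊗ₜ[ℂ] (K r ^ n) := by
  rw [map_pow, comulHom, lift_K, Algebra.TensorProduct.tmul_pow]

lemma comulHom_monomial (r a b c : ℕ) : comulHom r (E r ^ a * F r ^ b * K r ^ c) =
    ∑ p ∈ Finset.HasAntidiagonal.antidiagonal a, ∑ s ∈ Finset.HasAntidiagonal.antidiagonal b,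
      (gauss (q r ^ 2) p.1 p.2 * gauss (q r ^ 2) s.1 s.2) •
        ((E r ^ p.2 * F r ^ s.1 * (Kinv r ^ s.2 * K r ^ c)) ⊗ₜ[ℂ]
          (E r ^ p.1 * (K r ^ p.2 * F r ^ s.2) * K r ^ c)) := by
  rw [map_mul, map_mul, comulHom_E_pow, comulHom_F_pow, comulHom_K_pow, Finset.sum_mul_sum,
    Finset.sum_mul]
  refine Finset.sum_congr rfl fun p _ => ?_
  rw [Finset.sum_mul]
  refine Finset.sum_congr rfl fun s _ => ?_
  rw [smul_mul_smul_comm, smul_mul_assoc, Algebra.TensorProduct.tmul_mul_tmul,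
    Algebra.TensorProduct.tmul_mul_tmul]
  simp only [mul_assoc]

lemma Kinv_pow_mul_K_pow (r n : ℕ) : Kinv r ^ n * K r ^ n = 1 := by
  have hc : Commute (Kinv r) (K r) := by rw [Commute, SemiconjBy, K_mul_Kinv, Kinv_mul_K]
  rw [← hc.mul_pow, Kinv_mul_K, one_pow]

lemma sum_antidiagonal_antidiagonal_eq_single {M : Type} [AddCommMonoid M] {a b : ℕ}
    {f : ℕ × ℕ → ℕ × ℕ → M}
    (p₀ s₀ : ℕ × ℕ) (hp : p₀.1 + p₀.2 = a) (hs : s₀.1 + s₀.2 = b)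
    (h : ∀ p s, p.1 + p.2 = a → s.1 + s.2 = b → p ≠ p₀ ∨ s ≠ s₀ → f p s = 0) :
    ∑ p ∈ Finset.HasAntidiagonal.antidiagonal a, ∑ s ∈ Finset.HasAntidiagonal.antidiagonal b,
      f p s = f p₀ s₀ := by
  rw [Finset.sum_eq_single p₀, Finset.sum_eq_single s₀]
  · intro s hs' hne
    exact h _ _ hp (Finset.HasAntidiagonal.mem_antidiagonal.1 hs') (Or.inr hne)
  · intro hn
    exact absurd (Finset.HasAntidiagonal.mem_antidiagonal.2 hs) hn
  · intro p hp' hne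
    exact Finset.sum_eq_zero fun s hs' => h _ _ (Finset.HasAntidiagonal.mem_antidiagonal.1 hp')
      (Finset.HasAntidiagonal.mem_antidiagonal.1 hs') (Or.inl hne)
  · intro hn
    exact absurd (Finset.HasAntidiagonal.mem_antidiagonal.2 hp) hn

lemma IsPreferred.apply_monomial' {r : ℕ} [NeZero r] {lam : Uq r →ₗ[ℂ] ℂ} (h : IsPreferred r lam)
    (i j k c : ℕ) : lam (E r ^ i * (K r ^ k * F r ^ j) * K r ^ c) =
      if i = r' r - 1 ∧ j = r' r - 1 ∧ (k + c) % r' r = r' r - 1 then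
        (((q r ^ 2)⁻¹) ^ k) ^ j * topValue r else 0 := by
  rw [K_pow_mul_F_pow, mul_smul_comm, smul_mul_assoc, ← mul_assoc, mul_assoc, ← pow_add, map_smul,
    h.apply_monomial, smul_eq_mul, mul_ite, mul_zero]

/-- A second tensor factor has degrees at most `a` in `E` and `b` in `F`. It can reach top degree
only if `a = b = r' - 1` and the first factor keeps neither `E` nor `F`; that factor is then `K^(-b)
K^c`. -/
lemma IsPreferred.isLeftIntegral {r : ℕ} [NeZero r] {lam : Uq r →ₗ[ℂ] ℂ} (h : IsPreferred r lam) :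
    IsLeftIntegral lam := by
  have hN := r'_pos r
  let f : Uq r →ₗ[ℂ] Uq r :=
    (TensorProduct.rid ℂ (Uq r)).toLinearMap ∘ₗ lam.lTensor (Uq r) ∘ₗ (comulHom r).toLinearMap
  have hfg : f = lam.smulRight (1 : Uq r) := by
    refine linearMap_ext_monomial fun a b c => ?_
    have hf : f (E r ^ a * F r ^ b * K r ^ c) =
        ∑ p ∈ Finset.HasAntidiagonal.antidiagonal a, ∑ s ∈ Finset.HasAntidiagonal.antidiagonal b,
          (gauss (q r ^ 2) p.1 p.2 * gauss (q r ^ 2) s.1 s.2) •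
            (lam (E r ^ p.1 * (K r ^ p.2 * F r ^ s.2) * K r ^ c) •
              (E r ^ p.2 * F r ^ s.1 * (Kinv r ^ s.2 * K r ^ c))) := by
      change TensorProduct.rid ℂ (Uq r) (lam.lTensor (Uq r) (comulHom r _)) = _
      rw [comulHom_monomial]
      simp only [map_sum, map_smul, LinearMap.lTensor_tmul, TensorProduct.rid_tmul]
    rw [hf, LinearMap.smulRight_apply, h.apply_monomial]
    by_cases hab : a < r' r ∧ b < r' r
    swap
    · rw [← hf, if_neg (by omega), zero_smul]
      rcases not_and_or.1 hab with ha | hb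
      · rw [pow_eq_zero_of_le (not_lt.1 ha) (E_pow r)]; simp
      · rw [pow_eq_zero_of_le (not_lt.1 hb) (F_pow r)]; simp
    by_cases htop : a = r' r - 1 ∧ b = r' r - 1
    · rw [sum_antidiagonal_antidiagonal_eq_single (a, 0) (0, b) (by simp) (by simp)]
      · rw [h.apply_monomial']
        simp only [gauss_zero_left, gauss_zero_right, mul_one, one_smul, pow_zero, one_mul,
          zero_add, one_pow]
        by_cases hc : c % r' r = r' r - 1
        -- Both `b` and `c` modulo `r'` equal `r' - 1`, so the remaining powers of `K` cancel to 1.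
        · rw [K_pow_mod r c, hc, htop.2, Kinv_pow_mul_K_pow]
        · rw [if_neg (by tauto), zero_smul, zero_smul]
      · rintro ⟨i, j⟩ ⟨s, t⟩ hp hs hne
        simp only [ne_eq, Prod.mk.injEq] at hp hs hne
        rw [h.apply_monomial', if_neg (by omega), zero_smul, smul_zero]
    · rw [if_neg (by tauto), zero_smul]
      refine Finset.sum_eq_zero fun p hp => Finset.sum_eq_zero fun s hs => ?_
      rw [Finset.HasAntidiagonal.mem_antidiagonal] at hp hs
      rw [h.apply_monomial', if_neg (by omega), zero_smul, smul_zero]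
  intro x
  exact LinearMap.congr_fun hfg x

/-! ### Verma modules and the existence of the preferred integral -/

lemma q_sq_ne_one {r : ℕ} (hr : 2 < r) : q r ^ 2 ≠ 1 :=
  (Complex.isPrimitiveRoot_exp r (by omega)).pow_ne_one_of_pos_of_lt two_ne_zero hr

lemma q_sub_inv_ne_zero {r : ℕ} (hr : 2 < r) : q r - (q r)⁻¹ ≠ 0 := by
  intro h
  apply q_sq_ne_one hr
  have h0 := q_ne_zero r
  field_simp at h
  linear_combination h

/-- Exchanging `E` with `F` and `K` with `K⁻¹`. -/
lemma IsRep.swap {r : ℕ} {A : Type} [Ring A] [Algebra ℂ A] {k l e f : A} (h : IsRep r k l e f) :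
    IsRep r l k f e where
  kl := h.lk
  lk := h.kl
  ke := by
    have h1 : l * (k * f) * l = f * l := by rw [← mul_assoc, h.lk, one_mul]
    rw [h.kf, mul_smul_comm, smul_mul_assoc, mul_assoc, mul_assoc, h.kl, mul_one] at h1
    rw [← h1, smul_smul, mul_inv_cancel₀ (pow_ne_zero 2 (q_ne_zero r)), one_smul]
  kf := by
    have h1 : l * (k * e) * l = e * l := by rw [← mul_assoc, h.lk, one_mul]
    rw [h.ke, mul_smul_comm, smul_mul_assoc, mul_assoc, mul_assoc, h.kl, mul_one] at h1
    rw [← h1, smul_smul, inv_mul_cancel₀ (pow_ne_zero 2 (q_ne_zero r)), one_smul]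
  ef := by rw [← neg_sub, h.ef, ← smul_neg, neg_sub]
  kp := by
    have hc : Commute k l := by rw [Commute, SemiconjBy, h.kl, h.lk]
    have h1 := hc.mul_pow (r' r)
    rw [h.kl, h.kp, one_pow, one_mul] at h1
    exact h1.symm
  ep := h.fp
  fp := h.ep

section Verma

variable (r : ℕ) (ν : ℂ)

/-- The coefficient of `E` on the `b`-th basis vector of the Verma module of highest weight `ν`. -/
def vermaCoeff (b : ℕ) : ℂ :=
  (ν * q r * (1 - ((q r ^ 2) ^ b)⁻¹) + ν⁻¹ * (q r)⁻¹ * (1 - (q r ^ 2) ^ b)) /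
    (q r - (q r)⁻¹) ^ 2

/-- Extension by zero. -/
def extend {N : ℕ} (φ : Fin N → ℂ) (k : ℕ) : ℂ := if h : k < N then φ ⟨k, h⟩ else 0

lemma extend_of_lt {N : ℕ} (φ : Fin N → ℂ) {k : ℕ} (h : k < N) : extend φ k = φ ⟨k, h⟩ :=
  dif_pos h

lemma extend_of_le {N : ℕ} (φ : Fin N → ℂ) {k : ℕ} (h : N ≤ k) : extend φ k = 0 :=
  dif_neg (not_lt.2 h)

lemma extend_add {N : ℕ} (φ ψ : Fin N → ℂ) (k : ℕ) :
    extend (φ + ψ) k = extend φ k + extend ψ k := by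
  unfold extend; split_ifs <;> simp

lemma extend_smul {N : ℕ} (c : ℂ) (φ : Fin N → ℂ) (k : ℕ) :
    extend (c • φ) k = c * extend φ k := by
  unfold extend; split_ifs <;> simp

/-- The action of `K` on the Verma module of highest weight `ν`. -/
def vermaK : Module.End ℂ (Fin (r' r) → ℂ) where
  toFun φ b := ν * ((q r ^ 2) ^ (b : ℕ))⁻¹ * φ b
  map_add' φ ψ := by ext b; simp [mul_add]
  map_smul' c φ := by ext b; simp; ring

/-- The action of `K⁻¹` on the Verma module of highest weight `ν`. -/
def vermaKinv : Module.End ℂ (Fin (r' r) → ℂ) where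
  toFun φ b := ν⁻¹ * (q r ^ 2) ^ (b : ℕ) * φ b
  map_add' φ ψ := by ext b; simp [mul_add]
  map_smul' c φ := by ext b; simp; ring

/-- The action of `E` on the Verma module of highest weight `ν`. -/
def vermaE : Module.End ℂ (Fin (r' r) → ℂ) where
  toFun φ b := vermaCoeff r ν (b + 1) * extend φ (b + 1)
  map_add' φ ψ := by ext b; simp [extend_add, mul_add]
  map_smul' c φ := by ext b; simp [extend_smul]; ring

/-- The action of `F` on the Verma module. -/
def vermaF : Module.End ℂ (Fin (r' r) → ℂ) where
  toFun φ b := if (b : ℕ) = 0 then 0 else extend φ (b - 1)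
  map_add' φ ψ := by ext b; simp only [extend_add, Pi.add_apply]; split_ifs <;> simp
  map_smul' c φ := by
    ext b; simp only [extend_smul, Pi.smul_apply, RingHom.id_apply, smul_eq_mul]
    split_ifs <;> simp

variable {r}

lemma vermaK_apply (φ : Fin (r' r) → ℂ) (b : Fin (r' r)) :
    vermaK r ν φ b = ν * ((q r ^ 2) ^ (b : ℕ))⁻¹ * φ b := rfl

lemma vermaKinv_apply (φ : Fin (r' r) → ℂ) (b : Fin (r' r)) :
    vermaKinv r ν φ b = ν⁻¹ * (q r ^ 2) ^ (b : ℕ) * φ b := rfl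

lemma vermaE_apply (φ : Fin (r' r) → ℂ) (b : Fin (r' r)) :
    vermaE r ν φ b = vermaCoeff r ν (b + 1) * extend φ (b + 1) := rfl

lemma vermaF_apply (φ : Fin (r' r) → ℂ) (b : Fin (r' r)) :
    vermaF r φ b = if (b : ℕ) = 0 then 0 else extend φ (b - 1) := rfl

lemma vermaK_pow_apply (n : ℕ) (φ : Fin (r' r) → ℂ) (b : Fin (r' r)) :
    (vermaK r ν ^ n) φ b = (ν * ((q r ^ 2) ^ (b : ℕ))⁻¹) ^ n * φ b := by
  induction n with
  | zero => simp
  | succ n ih => rw [pow_succ', Module.End.mul_apply, vermaK_apply, ih]; ring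

lemma vermaE_pow_apply_eq_zero (n : ℕ) (φ : Fin (r' r) → ℂ) (b : Fin (r' r))
    (h : r' r ≤ b + n) : (vermaE r ν ^ n) φ b = 0 := by
  induction n generalizing b with
  | zero => have := b.2; omega
  | succ n ih =>
    rw [pow_succ', Module.End.mul_apply, vermaE_apply]
    by_cases hb : (b : ℕ) + 1 < r' r
    · rw [extend_of_lt _ hb, ih _ (by simp only; omega), mul_zero]
    · rw [extend_of_le _ (by omega), mul_zero]

lemma vermaF_pow_apply (n : ℕ) (φ : Fin (r' r) → ℂ) (b : Fin (r' r)) :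
    (vermaF r ^ n) φ b = if (b : ℕ) < n then 0 else extend φ (b - n) := by
  induction n generalizing b with
  | zero => simp [extend_of_lt]
  | succ n ih =>
    have hb := b.2
    rw [pow_succ', Module.End.mul_apply, vermaF_apply]
    by_cases h0 : (b : ℕ) = 0
    · simp [h0]
    · rw [if_neg h0, extend_of_lt _ (by omega), ih]
      simp only
      by_cases h1 : (b : ℕ) < n + 1
      · rw [if_pos (by omega), if_pos h1]
      · rw [if_neg (by omega), if_neg h1]
        congr 1
        omega

variable {ν}

lemma vermaCoeff_zero : vermaCoeff r ν 0 = 0 := by simp [vermaCoeff]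

/-- This vanishing, due to `(q²)^r' = 1` and valid for every `ν`, permits truncating the Verma
module to dimension `r'`. -/
lemma vermaCoeff_r' [NeZero r] : vermaCoeff r ν (r' r) = 0 := by
  simp [vermaCoeff, (isPrimitiveRoot_q_sq (NeZero.ne r)).pow_eq_one]

/-- This difference is the eigenvalue of `EF - FE` on the `b`-th weight vector, so the identity is
the relation for `[E, F]`. -/
lemma vermaCoeff_succ_sub (hr : 2 < r) (hν : ν ≠ 0) (b : ℕ) :
    vermaCoeff r ν (b + 1) - vermaCoeff r ν b =
      (q r - (q r)⁻¹)⁻¹ * (ν * ((q r ^ 2) ^ b)⁻¹ - ν⁻¹ * (q r ^ 2) ^ b) := by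
  have h0 := q_ne_zero r
  have h1 := q_sub_inv_ne_zero hr
  have hz : (q r ^ 2) ^ b ≠ 0 := pow_ne_zero _ (pow_ne_zero _ h0)
  have hnum : ν * q r * (1 - ((q r ^ 2) ^ (b + 1))⁻¹) +
      ν⁻¹ * (q r)⁻¹ * (1 - (q r ^ 2) ^ (b + 1)) -
      (ν * q r * (1 - ((q r ^ 2) ^ b)⁻¹) + ν⁻¹ * (q r)⁻¹ * (1 - (q r ^ 2) ^ b)) =
      (q r - (q r)⁻¹) * (ν * ((q r ^ 2) ^ b)⁻¹ - ν⁻¹ * (q r ^ 2) ^ b) := by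
    rw [pow_succ (q r ^ 2) b]
    generalize (q r ^ 2) ^ b = z at hz
    field_simp
    ring
  rw [vermaCoeff, vermaCoeff, ← sub_div, hnum, pow_two (q r - (q r)⁻¹),
    mul_div_mul_left _ _ h1, div_eq_inv_mul]

lemma isRep_verma [NeZero r] (hr : 2 < r) (hν : ν ^ r' r = 1) :
    IsRep r (vermaK r ν) (vermaKinv r ν) (vermaE r ν) (vermaF r) := by
  have hN := r'_ne_zero r
  have hν0 : ν ≠ 0 := by rintro rfl; rw [zero_pow hN] at hν; exact zero_ne_one hν
  have hz0 : q r ^ 2 ≠ 0 := pow_ne_zero _ (q_ne_zero r)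
  have hz : (q r ^ 2) ^ r' r = 1 := (isPrimitiveRoot_q_sq (NeZero.ne r)).pow_eq_one
  constructor
  · refine LinearMap.ext fun φ => funext fun b => ?_
    rw [Module.End.mul_apply, vermaK_apply, vermaKinv_apply, Module.End.one_apply]
    have := pow_ne_zero (b : ℕ) hz0
    field_simp
  · refine LinearMap.ext fun φ => funext fun b => ?_
    rw [Module.End.mul_apply, vermaKinv_apply, vermaK_apply, Module.End.one_apply]
    have := pow_ne_zero (b : ℕ) hz0
    field_simp
  · refine LinearMap.ext fun φ => funext fun b => ?_
    rw [Module.End.mul_apply, vermaK_apply, vermaE_apply, LinearMap.smul_apply, Pi.smul_apply,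
      Module.End.mul_apply, vermaE_apply, smul_eq_mul]
    by_cases hb : (b : ℕ) + 1 < r' r
    · rw [extend_of_lt _ hb, extend_of_lt _ hb, vermaK_apply]
      simp only [pow_succ (q r ^ 2)]
      have := pow_ne_zero (b : ℕ) hz0
      have := q_ne_zero r
      field_simp
    · rw [extend_of_le _ (by omega), extend_of_le _ (by omega)]; ring
  · refine LinearMap.ext fun φ => funext fun b => ?_
    rw [Module.End.mul_apply, vermaK_apply, vermaF_apply, LinearMap.smul_apply, Pi.smul_apply,
      Module.End.mul_apply, vermaF_apply, smul_eq_mul]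
    by_cases hb : (b : ℕ) = 0
    · simp [hb]
    · have hb2 := b.2
      rw [if_neg hb, if_neg hb, extend_of_lt _ (by omega), extend_of_lt _ (by omega),
        vermaK_apply]
      simp only
      obtain ⟨c, hc⟩ := Nat.exists_eq_succ_of_ne_zero hb
      simp only [hc, Nat.succ_eq_add_one, Nat.add_sub_cancel, pow_succ]
      have := pow_ne_zero c hz0
      field_simp
  · refine LinearMap.ext fun φ => funext fun b => ?_
    have hb2 := b.2
    have h1 : vermaE r ν (vermaF r φ) b = vermaCoeff r ν (b + 1) * φ b := by
      rw [vermaE_apply]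
      by_cases hb : (b : ℕ) + 1 < r' r
      · rw [extend_of_lt _ hb, vermaF_apply, if_neg (by simp)]
        simp only [Nat.add_sub_cancel]
        rw [extend_of_lt _ hb2]
      -- On the last basis vector `F` is truncated to zero, consistently with the vanishing
      -- coefficient.
      · rw [show (b : ℕ) + 1 = r' r by omega, vermaCoeff_r', zero_mul, zero_mul]
    have h2 : vermaF r (vermaE r ν φ) b = vermaCoeff r ν b * φ b := by
      rw [vermaF_apply]
      by_cases hb : (b : ℕ) = 0
      · rw [if_pos hb, hb, vermaCoeff_zero, zero_mul]
      · rw [if_neg hb, extend_of_lt _ (by omega), vermaE_apply]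
        simp only [Nat.sub_add_cancel (Nat.pos_of_ne_zero hb)]
        rw [extend_of_lt _ hb2]
    rw [LinearMap.sub_apply, Pi.sub_apply, Module.End.mul_apply, Module.End.mul_apply, h1, h2,
      ← sub_mul, vermaCoeff_succ_sub hr hν0, LinearMap.smul_apply, Pi.smul_apply,
      LinearMap.sub_apply, Pi.sub_apply, vermaK_apply, vermaKinv_apply, smul_eq_mul]
    ring
  · refine LinearMap.ext fun φ => funext fun b => ?_
    rw [vermaK_pow_apply, mul_pow, hν, inv_pow, ← pow_mul, mul_comm (b : ℕ), pow_mul, hz]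
    simp
  · refine LinearMap.ext fun φ => funext fun b => ?_
    rw [vermaE_pow_apply_eq_zero _ _ _ _ (by omega)]
    rfl
  · refine LinearMap.ext fun φ => funext fun b => ?_
    rw [vermaF_pow_apply, if_pos b.2]
    rfl

end Verma

/-! ### Matrix coefficients and the Fourier sum defining the integral. -/

section Integral

variable {r : ℕ} [NeZero r]

/-- The highest weight vector. -/
def topVector (r : ℕ) [NeZero r] : Fin (r' r) → ℂ :=
  Pi.single ⟨0, r'_pos r⟩ 1

/-- The last coordinate. -/
def lastCoord (r : ℕ) [NeZero r] : (Fin (r' r) → ℂ) →ₗ[ℂ] ℂ :=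
  LinearMap.proj ⟨r' r - 1, Nat.sub_lt (r'_pos r) one_pos⟩

/-- The matrix coefficient of a representation between the highest weight vector and the last
coordinate. -/
def coeffForm {k l e f : Module.End ℂ (Fin (r' r) → ℂ)} (h : IsRep r k l e f) :
    Uq r →ₗ[ℂ] ℂ :=
  lastCoord r ∘ₗ LinearMap.applyₗ (topVector r) ∘ₗ (lift r h).toLinearMap

lemma coeffForm_apply {k l e f : Module.End ℂ (Fin (r' r) → ℂ)} (h : IsRep r k l e f)
    (x : Uq r) : coeffForm h x = lastCoord r (lift r h x (topVector r)) := rfl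

lemma extend_topVector (k : ℕ) : extend (topVector r) k = if k = 0 then 1 else 0 := by
  have := r'_pos r
  by_cases hk : k < r' r
  · rw [extend_of_lt _ hk, topVector, Pi.single_apply]
    simp
  · rw [extend_of_le _ (by omega), if_neg (by omega)]

lemma lastCoord_vermaF_pow (n : ℕ) (hn : n < r' r) :
    lastCoord r ((vermaF r ^ n) (topVector r)) = if n = r' r - 1 then 1 else 0 := by
  rw [lastCoord, LinearMap.proj_apply, vermaF_pow_apply, extend_topVector]
  simp only
  rw [if_neg (by omega)]
  congr 1
  simp only [eq_iff_iff]
  omega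

lemma lastCoord_vermaE (ν : ℂ) (φ : Fin (r' r) → ℂ) : lastCoord r (vermaE r ν φ) = 0 := by
  have := r'_pos r
  rw [lastCoord, LinearMap.proj_apply, vermaE_apply, extend_of_le _ (by simp only; omega),
    mul_zero]

lemma vermaE_topVector (ν : ℂ) : vermaE r ν (topVector r) = 0 := by
  funext b
  rw [vermaE_apply, extend_topVector, if_neg (by omega), mul_zero]
  rfl

lemma vermaK_topVector (ν : ℂ) : vermaK r ν (topVector r) = ν • topVector r := by
  funext b
  rw [vermaK_apply, topVector, Pi.smul_apply, Pi.single_apply]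
  split_ifs with h
  · simp [h]
  · simp

lemma vermaK_pow_topVector (ν : ℂ) (n : ℕ) :
    (vermaK r ν ^ n) (topVector r) = ν ^ n • topVector r := by
  induction n with
  | zero => simp
  | succ n ih =>
    rw [pow_succ', Module.End.mul_apply, ih, map_smul, vermaK_topVector, smul_smul, pow_succ]

lemma vermaKinv_topVector : vermaKinv r 1 (topVector r) = topVector r := by
  funext b
  rw [vermaKinv_apply, topVector, Pi.single_apply]
  split_ifs with h
  · simp [h]
  · simp

lemma vermaKinv_pow_topVector (n : ℕ) : (vermaKinv r 1 ^ n) (topVector r) = topVector r := by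
  induction n with
  | zero => simp
  | succ n ih => rw [pow_succ', Module.End.mul_apply, ih, vermaKinv_topVector]

lemma lastCoord_vermaK_pow (ν : ℂ) (n : ℕ) (φ : Fin (r' r) → ℂ) :
    lastCoord r ((vermaK r ν ^ n) φ) =
      (ν * ((q r ^ 2) ^ (r' r - 1))⁻¹) ^ n * lastCoord r φ := by
  rw [lastCoord, LinearMap.proj_apply, vermaK_pow_apply]
  rfl

/-- In the swapped module of weight 1, `K` fixes the generating vector, `F` kills it and `E` shifts
the basis by one. -/
lemma coeffForm_lowest (hr : 2 < r) (i j n c : ℕ) (hi : i < r' r) :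
    coeffForm (isRep_verma hr (one_pow (r' r))).swap
      (E r ^ i * F r ^ j * (Kinv r ^ n * K r ^ c)) =
      if i = r' r - 1 ∧ j = 0 then 1 else 0 := by
  rw [coeffForm_apply]
  simp only [map_mul, map_pow, lift_E, lift_F, lift_K, lift_Kinv, Module.End.mul_apply]
  rw [vermaKinv_pow_topVector, vermaK_pow_topVector, one_pow, one_smul]
  rcases Nat.eq_zero_or_pos j with rfl | hj
  · rw [pow_zero, Module.End.one_apply, lastCoord_vermaF_pow i hi]
    simp
  · obtain ⟨j, rfl⟩ := Nat.exists_eq_succ_of_ne_zero hj.ne'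
    rw [pow_succ, Module.End.mul_apply, vermaE_topVector]
    simp

/-- No image of `E` has a component on the last basis vector, so `i = 0`. The powers of `K`
contribute the weights of the first and of the last basis vector. -/
lemma coeffForm_highest (hr : 2 < r) {ν : ℂ} (hν : ν ^ r' r = 1) (i k j c : ℕ)
    (hj : j < r' r) :
    coeffForm (isRep_verma hr hν) (E r ^ i * (K r ^ k * F r ^ j) * K r ^ c) =
      if i = 0 ∧ j = r' r - 1 then ν ^ c * (ν * ((q r ^ 2) ^ (r' r - 1))⁻¹) ^ k else 0 := by
  rw [coeffForm_apply]
  simp only [map_mul, map_pow, lift_E, lift_F, lift_K, Module.End.mul_apply]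
  rw [vermaK_pow_topVector]
  simp only [map_smul, smul_eq_mul]
  rcases Nat.eq_zero_or_pos i with rfl | hi
  · rw [pow_zero, Module.End.one_apply, lastCoord_vermaK_pow, lastCoord_vermaF_pow j hj]
    simp
  · obtain ⟨i, rfl⟩ := Nat.exists_eq_succ_of_ne_zero hi.ne'
    rw [pow_succ', Module.End.mul_apply, lastCoord_vermaE]
    simp

/-- The convolution of the matrix coefficients of a lowest weight and a highest weight module. -/
def weightForm (hr : 2 < r) {ν : ℂ} (hν : ν ^ r' r = 1) : Uq r →ₗ[ℂ] ℂ :=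
  LinearMap.mul' ℂ ℂ ∘ₗ
    TensorProduct.map (coeffForm (isRep_verma hr (one_pow (r' r))).swap)
      (coeffForm (isRep_verma hr hν)) ∘ₗ (comulHom r).toLinearMap

/-- The lowest weight coefficient sees only `E^(r'-1)` and the highest weight one only `F^(r'-1)`.
Together they select the single coproduct term sending all of `E^a` to the left and all of `F^b` to
the right. -/
lemma weightForm_monomial (hr : 2 < r) {ν : ℂ} (hν : ν ^ r' r = 1) {a b : ℕ} (ha : a < r' r)
    (hb : b < r' r) (c : ℕ) : weightForm hr hν (E r ^ a * F r ^ b * K r ^ c) =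
      if a = r' r - 1 ∧ b = r' r - 1 then
        ν ^ c * (ν * ((q r ^ 2) ^ (r' r - 1))⁻¹) ^ (r' r - 1) else 0 := by
  have hf : weightForm hr hν (E r ^ a * F r ^ b * K r ^ c) =
      ∑ p ∈ Finset.HasAntidiagonal.antidiagonal a, ∑ s ∈ Finset.HasAntidiagonal.antidiagonal b,
        (gauss (q r ^ 2) p.1 p.2 * gauss (q r ^ 2) s.1 s.2) *
          (coeffForm (isRep_verma hr (one_pow (r' r))).swap
            (E r ^ p.2 * F r ^ s.1 * (Kinv r ^ s.2 * K r ^ c)) *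
          coeffForm (isRep_verma hr hν) (E r ^ p.1 * (K r ^ p.2 * F r ^ s.2) * K r ^ c)) := by
    change LinearMap.mul' ℂ ℂ (TensorProduct.map _ _ (comulHom r _)) = _
    rw [comulHom_monomial]
    simp only [map_sum, map_smul, TensorProduct.map_tmul, LinearMap.mul'_apply, smul_eq_mul]
  rw [hf]
  by_cases htop : a = r' r - 1 ∧ b = r' r - 1
  · rw [sum_antidiagonal_antidiagonal_eq_single (0, a) (0, b) (by simp) (by simp)]
    · simp only
      rw [coeffForm_lowest hr _ _ _ _ ha, coeffForm_highest hr hν _ _ _ _ hb,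
        if_pos ⟨htop.1, rfl⟩, if_pos ⟨rfl, htop.2⟩, if_pos htop, htop.1]
      simp [gauss_zero_left]
    · rintro ⟨i, j⟩ ⟨s, t⟩ hp hs hne
      simp only [ne_eq, Prod.mk.injEq] at hp hs hne
      simp only
      rw [coeffForm_lowest hr _ _ _ _ (by omega), if_neg (by omega), zero_mul, mul_zero]
  · rw [if_neg htop]
    refine Finset.sum_eq_zero fun p hp => Finset.sum_eq_zero fun s hs => ?_
    rw [Finset.HasAntidiagonal.mem_antidiagonal] at hp hs
    rw [coeffForm_lowest hr _ _ _ _ (by omega), coeffForm_highest hr hν _ _ _ _ (by omega)]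
    by_cases h1 : p.2 = r' r - 1 ∧ s.1 = 0
    · rw [if_neg (c := p.1 = 0 ∧ _) (by omega), mul_zero, mul_zero]
    · rw [if_neg h1, zero_mul, mul_zero]

lemma q_sq_pow_pow (k : ℕ) : ((q r ^ 2) ^ k) ^ r' r = 1 := by
  rw [pow_right_comm, (isPrimitiveRoot_q_sq (NeZero.ne r)).pow_eq_one, one_pow]

/-- The preferred integral. -/
def integral (hr : 2 < r) : Uq r →ₗ[ℂ] ℂ :=
  (topValue r / r' r) • ∑ k ∈ Finset.range (r' r),
    ((q r ^ 2) ^ k * (((q r ^ 2) ^ k * ((q r ^ 2) ^ (r' r - 1))⁻¹) ^ (r' r - 1))⁻¹) •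
      weightForm hr (q_sq_pow_pow k)

lemma sum_pow_pow_eq {ω : ℂ} {N : ℕ} (hω : IsPrimitiveRoot ω N) (m : ℕ) :
    ∑ k ∈ Finset.range N, (ω ^ k) ^ m = if N ∣ m then (N : ℂ) else 0 := by
  simp only [pow_right_comm ω _ m]
  split_ifs with h
  · simp [(hω.pow_eq_one_iff_dvd m).2 h]
  · have h1 : ω ^ m ≠ 1 := fun h2 => h ((hω.pow_eq_one_iff_dvd m).1 h2)
    rw [geom_sum_eq h1, pow_right_comm, hω.pow_eq_one, one_pow, sub_self, zero_div]

/-- The weights cancel the factor of `weightForm` independent of `c` and leave one extra `ν`. The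
sum of `ν^(c+1)` over all `r'`-th roots of unity vanishes unless `c = r' - 1`. -/
lemma isPreferred_integral (hr : 2 < r) : IsPreferred r (integral hr) := by
  intro a b c ha hb hc
  have hz0 : q r ^ 2 ≠ 0 := pow_ne_zero _ (q_ne_zero r)
  have hz := isPrimitiveRoot_q_sq (NeZero.ne r)
  have hN := r'_ne_zero r
  rw [integral, LinearMap.smul_apply, LinearMap.sum_apply]
  simp only [LinearMap.smul_apply, weightForm_monomial hr _ ha hb, smul_eq_mul]
  by_cases htop : a = r' r - 1 ∧ b = r' r - 1
  · simp only [if_pos htop]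
    have h1 : ∀ k ∈ Finset.range (r' r),
        (q r ^ 2) ^ k * (((q r ^ 2) ^ k * ((q r ^ 2) ^ (r' r - 1))⁻¹) ^ (r' r - 1))⁻¹ *
          (((q r ^ 2) ^ k) ^ c *
            ((q r ^ 2) ^ k * ((q r ^ 2) ^ (r' r - 1))⁻¹) ^ (r' r - 1)) =
        ((q r ^ 2) ^ k) ^ (c + 1) := by
      intro k _
      have h2 : ((q r ^ 2) ^ k * ((q r ^ 2) ^ (r' r - 1))⁻¹) ^ (r' r - 1) ≠ 0 :=
        pow_ne_zero _ (mul_ne_zero (pow_ne_zero _ hz0) (inv_ne_zero (pow_ne_zero _ hz0)))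
      generalize ((q r ^ 2) ^ k * ((q r ^ 2) ^ (r' r - 1))⁻¹) ^ (r' r - 1) = y at h2
      field_simp
      ring
    rw [Finset.sum_congr rfl h1, sum_pow_pow_eq hz]
    by_cases hcN : c = r' r - 1
    · rw [if_pos (by rw [hcN, Nat.sub_add_cancel (r'_pos r)]), if_pos ⟨htop.1, htop.2, hcN⟩,
        div_mul_cancel₀ _ (Nat.cast_ne_zero.2 hN), topValue]
    · rw [if_neg, if_neg (by tauto), mul_zero]
      intro hd
      have := Nat.le_of_dvd (Nat.succ_pos c) hd
      omega
  · simp only [if_neg htop]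
    rw [if_neg (by tauto)]
    simp

end Integral

/-! ### The stabilization coefficient as a Gauss sum -/

section Stabilization

variable {r : ℕ}

lemma antipodeLin_pow (r : ℕ) (x : Uq r) (n : ℕ) : antipodeLin r (x ^ n) = antipodeLin r x ^ n := by
  induction n with
  | zero => simp [antipodeLin_one]
  | succ n ih => rw [pow_succ, antipodeLin_mul, ih, ← pow_succ']

lemma K_mul_F_pow (r n : ℕ) :
    (K r * F r) ^ n = (q r)⁻¹ ^ (n * (n + 1)) • (F r ^ n * K r ^ n) := by
  induction n with
  | zero => simp
  | succ n ih =>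
    rw [pow_succ, ih, K_mul_F, smul_mul_smul_comm, mul_assoc, ← mul_assoc (K r ^ n), K_pow_mul_F,
      smul_mul_assoc, mul_smul_comm, smul_smul, mul_assoc (F r), ← pow_succ, ← mul_assoc,
      ← pow_succ, ← inv_pow, ← pow_mul, ← pow_add, ← pow_add]
    congr 2
    ring

lemma drinfeldElement_RMatrix (r : ℕ) [NeZero r] : drinfeldElement (RMatrix r) =
    (1 / (r' r : ℂ)) •
    ∑ a ∈ Finset.range (r' r), ∑ b ∈ Finset.range (r' r), ∑ c ∈ Finset.range (r' r),
      (qBrace r 1 ^ a / qFact r a * q r ^ (((a * (a - 1) / 2 : ℕ) : ℤ) - 2 * b * c)) •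
        ((-(K r * F r)) ^ a * Kinv r ^ c * (K r ^ b * E r ^ a)) := by
  have hS : ∀ x, HopfAlgebra.antipode ℂ (A := Uq r) x = antipodeLin r x := fun _ => rfl
  simp only [drinfeldElement, RMatrix, map_smul, map_sum, TensorProduct.comm_tmul,
    LinearMap.rTensor_tmul, LinearMap.mul'_apply, hS, antipodeLin_mul, antipodeLin_pow,
    antipodeLin_K, antipodeLin_F]

lemma IsPreferred.apply_F_pow_mul_E_pow [NeZero r] {lam : Uq r →ₗ[ℂ] ℂ} (h : IsPreferred r lam)
    {a : ℕ} (ha : a < r' r) (n : ℕ) : lam (F r ^ a * E r ^ a * K r ^ n) =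
      if a = r' r - 1 ∧ n % r' r = r' r - 1 then topValue r else 0 := by
  have h1 := mul_K_pow_mem (F_pow_mul_E_pow_sub_mem r a a) n
  have h2 := h.apply_eq_zero (monomialSpan_mono (by omega) h1)
  rw [sub_mul, map_sub, sub_eq_zero, h.apply_monomial] at h2
  rw [h2]
  congr 1
  simp only [eq_iff_iff]
  tauto

/-- With `K⁻¹ = K^(r'-1)`, all powers of `K` are collected on the right. For `a = r' - 1` the total
exponent is `b - c - 2` modulo `r'`, and it must be `-1`. -/
lemma IsPreferred.apply_ribbon_term [NeZero r] {lam : Uq r →ₗ[ℂ] ℂ} (h : IsPreferred r lam)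
    {a : ℕ} (ha : a < r' r) (b c : ℕ) :
    lam ((-(K r * F r)) ^ a * Kinv r ^ c * (K r ^ b * E r ^ a) * Kinv r) =
      if a = r' r - 1 ∧ b ≡ c + 1 [MOD r' r] then
        (-1) ^ a * (q r)⁻¹ ^ (a * (a + 1)) * topValue r else 0 := by
  obtain ⟨N, hN⟩ := Nat.exists_eq_succ_of_ne_zero (r'_ne_zero r)
  have hz := isPrimitiveRoot_q_sq (NeZero.ne r)
  have h1 : (-(K r * F r)) ^ a * Kinv r ^ c * (K r ^ b * E r ^ a) * Kinv r =
      ((-1) ^ a * (q r)⁻¹ ^ (a * (a + 1)) * ((q r ^ 2) ^ (a + N * c + b)) ^ a) •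
        (F r ^ a * E r ^ a * K r ^ (a + N * c + b + N)) := by
    rw [Kinv_eq_pow, hN, Nat.succ_sub_one, neg_pow, K_mul_F_pow, ← pow_mul]
    have h2 : F r ^ a * K r ^ a * K r ^ (N * c) * (K r ^ b * E r ^ a) * K r ^ N =
        ((q r ^ 2) ^ (a + N * c + b)) ^ a •
          (F r ^ a * E r ^ a * K r ^ (a + N * c + b + N)) := by
      have h3 := K_pow_mul_E_pow r (a + N * c + b) a
      have h4 : F r ^ a * (K r ^ (a + N * c + b) * E r ^ a) * K r ^ N =
          ((q r ^ 2) ^ (a + N * c + b)) ^ a •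
            (F r ^ a * E r ^ a * K r ^ (a + N * c + b + N)) := by
        rw [h3, mul_smul_comm, smul_mul_assoc, pow_add (K r) _ N]
        simp only [mul_assoc]
      rw [← h4, pow_add, pow_add]
      simp only [mul_assoc]
    have h4 : ((-1 : Uq r)) ^ a = ((-1 : ℂ) ^ a) • (1 : Uq r) := by
      rcases Nat.even_or_odd a with h | h <;> simp [h.neg_one_pow]
    rw [h4, smul_one_mul, smul_smul, smul_mul_assoc, smul_mul_assoc, smul_mul_assoc, h2, smul_smul]
  rw [h1, map_smul, h.apply_F_pow_mul_E_pow ha, smul_eq_mul, mul_ite, mul_zero]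
  rw [hN, Nat.succ_sub_one] at *
  by_cases haN : a = N
  swap
  · rw [if_neg (by tauto), if_neg (by tauto)]
  subst haN
  have hiff : (a + a * c + b + a) % (a + 1) = a ↔ b ≡ c + 1 [MOD a + 1] := by
    -- Adding `c + 2` undoes the inverses written as `K^a`, leaving `b` modulo `a + 1 = r'`.
    have e1 : (a + a * c + b + a) + (c + 2) = b + (a + 1) * (c + 2) := by ring
    have e2 : (a + a * c + b + a) % (a + 1) = a ↔ a + a * c + b + a ≡ a [MOD a + 1] := by
      rw [Nat.ModEq, Nat.mod_eq_of_lt a.lt_succ_self]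
    rw [e2]
    constructor
    · intro h5
      have h6 := h5.add_right (c + 2)
      rw [e1] at h6
      have h7 : a + (c + 2) = (c + 1) + (a + 1) * 1 := by ring
      rw [h7] at h6
      exact Nat.ModEq.trans (by simp [Nat.ModEq]) (h6.trans (by simp [Nat.ModEq]))
    · intro h5
      refine Nat.ModEq.add_right_cancel' (c + 2) ?_
      rw [e1]
      have h7 : a + (c + 2) = (c + 1) + (a + 1) * 1 := by ring
      rw [h7]
      exact Nat.ModEq.trans (by simp [Nat.ModEq]) (h5.trans (by simp [Nat.ModEq]))
  by_cases hb : b ≡ c + 1 [MOD a + 1]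
  -- The scalar from moving `K` past `E^a` is a power of `q²` with exponent divisible by `r'`, hence
  -- 1.
  · have hd : a + 1 ∣ a + a * c + b := by
      have h5 : a + a * c + b ≡ a + a * c + (c + 1) [MOD a + 1] := hb.add_left _
      have h6 : a + a * c + (c + 1) = (a + 1) * (c + 1) := by ring
      rw [h6] at h5
      exact (Nat.modEq_zero_iff_dvd.1 (h5.trans (by simp [Nat.ModEq])))
    rw [if_pos ⟨rfl, hiff.2 hb⟩, if_pos ⟨rfl, hb⟩, (hz.pow_eq_one_iff_dvd _).2 hd, one_pow, mul_one]
  · rw [if_neg (by tauto), if_neg (by tauto)]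

lemma qBrace_ne_zero (hr : 2 < r) : qBrace r 1 ≠ 0 := by
  simpa [qBrace] using q_sub_inv_ne_zero hr

lemma qFact_ne_zero (hr : 2 < r) {n : ℕ} (hn : n < r' r) : qFact r n ≠ 0 := by
  refine Finset.prod_ne_zero_iff.2 fun k hk => div_ne_zero ?_ (qBrace_ne_zero hr)
  have hk' := Finset.mem_range.1 hk
  have hz := (isPrimitiveRoot_q_sq (r := r) (by omega)).pow_ne_one_of_pos_of_lt
    (Nat.succ_ne_zero k) (by omega)
  intro h
  apply hz
  rw [qBrace, sub_eq_zero, zpow_neg] at h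
  have h0 : q r ^ ((k : ℤ) + 1) ≠ 0 := zpow_ne_zero _ (q_ne_zero r)
  have h1 : q r ^ ((k : ℤ) + 1) = q r ^ (k + 1) := by norm_cast
  rw [h1] at h h0
  rw [← pow_mul, mul_comm 2, pow_mul, pow_two]
  nth_rw 1 [h]
  exact inv_mul_cancel₀ h0

/-- For even `r`, `q^r' = -1` cancels the sign; for odd `r`, `q^r' = 1` and `r' - 1` is even. -/
lemma neg_one_pow_mul_q_pow [NeZero r] :
    (-1 : ℂ) ^ (r' r - 1) * (q r)⁻¹ ^ ((r' r - 1) * (r' r - 1 + 1)) = 1 := by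
  have hr := NeZero.ne r
  rw [Nat.sub_add_cancel (r'_pos r), mul_comm (r' r - 1), pow_mul, ← mul_pow]
  rcases Nat.even_or_odd r with he | ho
  · have h2 : r = r' r * 2 := by
      rw [r', Nat.gcd_eq_right he.two_dvd, Nat.div_mul_cancel he.two_dvd]
    have h3 := ((Complex.isPrimitiveRoot_exp r hr).pow (Nat.pos_of_ne_zero hr) h2)
    have h4 : q r ^ r' r = -1 := h3.eq_neg_one_of_two_right
    rw [inv_pow, h4]; norm_num
  · have h2 : r' r = r := by rw [r', (Nat.coprime_two_right.2 ho).gcd_eq_one, Nat.div_one]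
    have h4 : q r ^ r = 1 := (Complex.isPrimitiveRoot_exp r hr).pow_eq_one
    rw [h2, inv_pow, h4, inv_one, mul_one, Even.neg_one_pow]
    exact Nat.Odd.sub_odd ho odd_one

lemma sum_ite_modEq_range {N : ℕ} (hN : 0 < N) (n : ℕ) (f : ℕ → ℂ)
    (hf : ∀ m, f (m % N) = f m) :
    ∑ b ∈ Finset.range N, (if b ≡ n [MOD N] then f b else 0) = f n := by
  rw [Finset.sum_eq_single (n % N)]
  · rw [if_pos (Nat.mod_modEq n N), hf]
  · intro b hb hne
    rw [if_neg]
    intro h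
    apply hne
    rw [← h, Nat.mod_eq_of_lt (Finset.mem_range.1 hb)]
  · intro h
    exact absurd (Finset.mem_range.2 (Nat.mod_lt n hN)) h

/-- The normalization of the form cancels the factor `{1}^a / [a]!` of the R-matrix at `a = r' - 1`.
With `b ≡ c + 1`, the exponent `-2bc` becomes `-2c(c+1)`. -/
theorem IsPreferred.apply_ribbonElement [NeZero r] (hr : 2 < r) {lam : Uq r →ₗ[ℂ] ℂ}
    (h : IsPreferred r lam) : lam (ribbonElement r) =
      (Real.sqrt (r'' r) : ℂ) / r' r * q r ^ ((r' r - 1) * (r' r - 2) / 2) *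
        ∑ c ∈ Finset.range (r' r), ((q r)⁻¹ ^ 2) ^ (c * (c + 1)) := by
  have hN := r'_pos r
  have hq := q_ne_zero r
  have hz := (isPrimitiveRoot_q_sq (NeZero.ne r)).pow_eq_one
  have hterm : ∀ b c : ℕ, qBrace r 1 ^ (r' r - 1) / qFact r (r' r - 1) *
      q r ^ ((((r' r - 1) * (r' r - 1 - 1) / 2 : ℕ) : ℤ) - 2 * b * c) * topValue r =
      (Real.sqrt (r'' r) : ℂ) * q r ^ ((r' r - 1) * (r' r - 2) / 2) *
        ((q r)⁻¹ ^ 2) ^ (b * c) := by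
    intro b c
    have h1 := pow_ne_zero (r' r - 1) (qBrace_ne_zero hr)
    have h2 := qFact_ne_zero hr (n := r' r - 1) (by omega)
    have h3 : q r ^ ((((r' r - 1) * (r' r - 1 - 1) / 2 : ℕ) : ℤ) - 2 * b * c) =
        q r ^ ((r' r - 1) * (r' r - 2) / 2) * ((q r)⁻¹ ^ 2) ^ (b * c) := by
      rw [sub_eq_add_neg, zpow_add₀ hq, zpow_natCast, Nat.sub_sub, ← pow_mul, inv_pow, zpow_neg]
      congr 2
      rw [← zpow_natCast]
      push_cast
      rw [mul_assoc]
    rw [h3, topValue]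
    field_simp
  rw [ribbonElement, drinfeldElement_RMatrix, smul_mul_assoc, map_smul, Finset.sum_mul, map_sum]
  rw [Finset.sum_eq_single (r' r - 1)]
  rotate_left
  · intro a ha hne
    simp only [Finset.sum_mul, smul_mul_assoc, map_sum, map_smul]
    refine Finset.sum_eq_zero fun b _ => Finset.sum_eq_zero fun c _ => ?_
    rw [h.apply_ribbon_term (Finset.mem_range.1 ha), if_neg (by tauto), smul_zero]
  · intro hn
    exact absurd (Finset.mem_range.2 (by omega)) hn
  simp only [Finset.sum_mul, smul_mul_assoc, map_sum, map_smul]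
  have hone : r' r - 1 < r' r := by omega
  simp only [h.apply_ribbon_term hone, neg_one_pow_mul_q_pow, one_mul, true_and, smul_eq_mul,
    mul_ite, mul_zero, hterm]
  rw [Finset.sum_comm]
  have hmod : ∀ c m : ℕ, ((q r)⁻¹ ^ 2) ^ (m % r' r * c) = ((q r)⁻¹ ^ 2) ^ (m * c) := by
    intro c m
    have h1 : ((q r)⁻¹ ^ 2) ^ r' r = 1 := by rw [inv_pow, inv_pow, hz, inv_one]
    rw [pow_mul, pow_mul, ← pow_eq_pow_mod m h1]
  have hc : ∀ c : ℕ, ∑ b ∈ Finset.range (r' r), (if b ≡ c + 1 [MOD r' r] then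
      (Real.sqrt (r'' r) : ℂ) * q r ^ ((r' r - 1) * (r' r - 2) / 2) *
        ((q r)⁻¹ ^ 2) ^ (b * c) else 0) =
      (Real.sqrt (r'' r) : ℂ) * q r ^ ((r' r - 1) * (r' r - 2) / 2) *
        ((q r)⁻¹ ^ 2) ^ (c * (c + 1)) := by
    intro c
    rw [sum_ite_modEq_range hN (c + 1) (fun b => (Real.sqrt (r'' r) : ℂ) *
      q r ^ ((r' r - 1) * (r' r - 2) / 2) * ((q r)⁻¹ ^ 2) ^ (b * c)), mul_comm (c + 1)]
    intro m
    simp only [hmod]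
  simp only [hc]
  rw [← Finset.mul_sum]
  ring

end Stabilization

/-! ### Gauss's evaluation of the quadratic Gauss sum -/

section GaussSum

/-- The second `q`-Pascal rule, needed alongside the defining one for Gauss's recursion. -/
lemma gauss_succ_succ' (ω : ℂ) (i j : ℕ) :
    gauss ω (i + 1) (j + 1) = ω ^ (j + 1) * gauss ω i (j + 1) + gauss ω (i + 1) j := by
  obtain ⟨hA, hB⟩ := gauss_step ω (i + j) i j rfl
  rw [gauss_succ_succ]
  linear_combination hB - hA

lemma sum_antidiagonal_succ_of_rec {G A B : ℕ → ℕ → ℂ}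
    (h : ∀ i j, G (i + 1) (j + 1) = A i (j + 1) + B (i + 1) j)
    (h₁ : ∀ i, G (i + 1) 0 = A i 0) (h₂ : ∀ j, G 0 (j + 1) = B 0 j) (m : ℕ) :
    ∑ p ∈ Finset.HasAntidiagonal.antidiagonal (m + 1), G p.1 p.2 =
      ∑ p ∈ Finset.HasAntidiagonal.antidiagonal m, A p.1 p.2 +
      ∑ p ∈ Finset.HasAntidiagonal.antidiagonal m, B p.1 p.2 := by
  let a : ℕ → ℕ → ℂ := fun i j => Nat.casesOn i 0 (fun i => A i j)
  let b : ℕ → ℕ → ℂ := fun i j => Nat.casesOn j 0 (fun j => B i j)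
  have hab : ∀ p ∈ Finset.HasAntidiagonal.antidiagonal (m + 1),
      G p.1 p.2 = a p.1 p.2 + b p.1 p.2 := by
    rintro ⟨i, j⟩ hp
    rw [Finset.HasAntidiagonal.mem_antidiagonal] at hp
    rcases i with _ | i <;> rcases j with _ | j
    · simp at hp
    · simp [a, b, h₂]
    · simp [a, b, h₁]
    · simp [a, b, h]
  rw [Finset.sum_congr rfl hab, Finset.sum_add_distrib, Finset.Nat.sum_antidiagonal_succ,
    Finset.Nat.sum_antidiagonal_succ']
  simp [a, b]

/-- Gauss's recursion for the alternating sum of Gaussian binomial coefficients. -/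
lemma sum_neg_one_pow_mul_gauss (ω : ℂ) (p : ℕ) :
    ∑ s ∈ Finset.HasAntidiagonal.antidiagonal (2 * p), (-1) ^ s.1 * gauss ω s.1 s.2 =
      ∏ k ∈ Finset.range p, (1 - ω ^ (2 * k + 1)) := by
  -- Let `f` be the alternating sum and `h` the sum with `(-ω)^i` as weights. The two Pascal rules
  -- give `f(m+1) = h(m) - f(m)` and `h(m+1) = h(m) - ω^(m+1) f(m)`, whence `f(m+2) = (1 - ω^(m+1))
  -- f(m)`.
  have hf : ∀ m : ℕ,
      ∑ s ∈ Finset.HasAntidiagonal.antidiagonal (m + 1), (-1) ^ s.1 * gauss ω s.1 s.2 =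
      ∑ s ∈ Finset.HasAntidiagonal.antidiagonal m, -((-1) ^ s.1 * gauss ω s.1 s.2) +
      ∑ s ∈ Finset.HasAntidiagonal.antidiagonal m, (-ω) ^ s.1 * gauss ω s.1 s.2 := by
    refine sum_antidiagonal_succ_of_rec (G := fun i j => (-1) ^ i * gauss ω i j)
      (A := fun i j => -((-1) ^ i * gauss ω i j)) (B := fun i j => (-ω) ^ i * gauss ω i j) ?_ ?_ ?_
    · intro i j
      simp only [gauss_succ_succ, neg_pow ω]
      ring
    · intro i
      simp only [gauss_zero_right]
      ring
    · intro j
      simp [gauss_zero_left]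
  have hh : ∀ m : ℕ,
      ∑ s ∈ Finset.HasAntidiagonal.antidiagonal (m + 1), (-ω) ^ s.1 * gauss ω s.1 s.2 =
      ∑ s ∈ Finset.HasAntidiagonal.antidiagonal m,
        -((-1) ^ s.1 * ω ^ (s.1 + s.2 + 1) * gauss ω s.1 s.2) +
      ∑ s ∈ Finset.HasAntidiagonal.antidiagonal m, (-ω) ^ s.1 * gauss ω s.1 s.2 := by
    refine sum_antidiagonal_succ_of_rec (G := fun i j => (-ω) ^ i * gauss ω i j)
      (A := fun i j => -((-1) ^ i * ω ^ (i + j + 1) * gauss ω i j))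
      (B := fun i j => (-ω) ^ i * gauss ω i j) ?_ ?_ ?_
    · intro i j
      simp only [gauss_succ_succ', neg_pow ω]
      ring
    · intro i
      simp only [gauss_zero_right, neg_pow ω]
      ring
    · intro j
      simp [gauss_zero_left]
  have hh' : ∀ m : ℕ, ∑ s ∈ Finset.HasAntidiagonal.antidiagonal m,
        -((-1) ^ s.1 * ω ^ (s.1 + s.2 + 1) * gauss ω s.1 s.2) =
      -ω ^ (m + 1) *
        ∑ s ∈ Finset.HasAntidiagonal.antidiagonal m, (-1) ^ s.1 * gauss ω s.1 s.2 := by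
    intro m
    rw [Finset.mul_sum]
    refine Finset.sum_congr rfl fun s hs => ?_
    rw [Finset.HasAntidiagonal.mem_antidiagonal.1 hs]
    ring
  induction p with
  | zero => simp [gauss_zero_left]
  | succ p ih =>
    rw [Finset.prod_range_succ, ← ih, show 2 * (p + 1) = 2 * p + 1 + 1 by ring, hf, hh, hh',
      Finset.sum_neg_distrib, hf, Finset.sum_neg_distrib]
    ring

lemma triangular_succ (i : ℕ) : (i + 1) * (i + 1 + 1) / 2 = i * (i + 1) / 2 + (i + 1) := by
  rw [show (i + 1) * (i + 1 + 1) = i * (i + 1) + 2 * (i + 1) by ring,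
    Nat.add_mul_div_left _ _ two_pos]

lemma triangular_mul_two (i : ℕ) : i * (i + 1) / 2 * 2 = i * (i + 1) :=
  Nat.div_mul_cancel (Nat.even_mul_succ_self i).two_dvd

/-- Since `1 - ω^(n-k) = -ω^(-k) (1 - ω^k)`, consecutive Gaussian binomials over `n - 1` differ by
the factor `-ω^(-(i+1))`. -/
lemma gauss_mul_pow_triangular {ω : ℂ} {n : ℕ} (hω : IsPrimitiveRoot ω n) (i j : ℕ)
    (h : i + j + 1 = n) : gauss ω i j * ω ^ (i * (i + 1) / 2) = (-1) ^ i := by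
  induction i generalizing j with
  | zero => simp [gauss_zero_left]
  | succ i ih =>
    have h1 := ih (j + 1) (by omega)
    obtain ⟨hA, hB⟩ := gauss_step ω (i + j) i j rfl
    have hne : (1 : ℂ) - ω ^ (i + 1) ≠ 0 :=
      sub_ne_zero.2 (hω.pow_ne_one_of_pos_of_lt (by omega) (by omega)).symm
    have hn : ω ^ (j + 1) * ω ^ (i + 1) = 1 := by
      rw [← pow_add, ← hω.pow_eq_one]; congr 1; omega
    have h2 : gauss ω (i + 1) j * ω ^ (i + 1) = - gauss ω i (j + 1) := by
      apply mul_left_cancel₀ hne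
      linear_combination ω ^ (i + 1) * (hA - hB) - gauss ω i (j + 1) * hn
    rw [triangular_succ, pow_add, pow_succ (-1 : ℂ), ← h1]
    linear_combination ω ^ (i * (i + 1) / 2) * h2

/-- Gauss's product formula. -/
theorem sum_inv_pow_triangular {ω : ℂ} {p : ℕ} (hω : IsPrimitiveRoot ω (2 * p + 1)) :
    ∑ i ∈ Finset.range (2 * p + 1), ω⁻¹ ^ (i * (i + 1) / 2) =
      ∏ k ∈ Finset.range p, (1 - ω ^ (2 * k + 1)) := by
  rw [← sum_neg_one_pow_mul_gauss, Finset.Nat.sum_antidiagonal_eq_sum_range_succ_mk]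
  refine Finset.sum_congr rfl fun i hi => ?_
  have h1 := gauss_mul_pow_triangular hω i (2 * p - i) (by have := Finset.mem_range.1 hi; omega)
  have h2 : ((-1 : ℂ) ^ i) * (-1) ^ i = 1 := by rw [← mul_pow]; simp
  rw [inv_pow]
  exact inv_eq_of_mul_eq_one_left (by linear_combination (-1) ^ i * h1 + h2)

/-- The product of all `1 - ω^k` with `0 < k < n` is `n = 2p + 1`, and `k ↦ n - k` matches even
exponents with odd ones by complex conjugation. -/
lemma norm_prod_one_sub_pow {ω : ℂ} {p : ℕ} (hω : IsPrimitiveRoot ω (2 * p + 1)) :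
    ‖∏ k ∈ Finset.range p, (1 - ω ^ (2 * k + 1))‖ = Real.sqrt ((2 * p + 1 : ℕ) : ℝ) := by
  have h1 := hω.prod_one_sub_pow_eq_order
  have hsplit : ∀ (f : ℕ → ℂ) (m : ℕ), ∏ k ∈ Finset.range (2 * m), f k =
      (∏ k ∈ Finset.range m, f (2 * k)) * ∏ k ∈ Finset.range m, f (2 * k + 1) := by
    intro f m
    induction m with
    | zero => simp
    | succ m ih =>
      rw [Nat.mul_succ, Finset.prod_range_succ, Finset.prod_range_succ, ih,
        Finset.prod_range_succ, Finset.prod_range_succ]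
      ring
  have hnorm : ‖ω‖ = 1 := hω.norm'_eq_one (by omega)
  have hconj : ∀ k ∈ Finset.range p, 1 - ω ^ (2 * (p - 1 - k) + 1 + 1) =
      (starRingEnd ℂ) (1 - ω ^ (2 * k + 1)) := by
    intro k hk
    have hk := Finset.mem_range.1 hk
    have h2 : ω ^ (2 * (p - 1 - k) + 1 + 1) * ω ^ (2 * k + 1) = 1 := by
      rw [← pow_add, ← hω.pow_eq_one]; congr 1; omega
    rw [map_sub, map_one, map_pow, ← Complex.inv_eq_conj hnorm, inv_pow,
      eq_inv_of_mul_eq_one_left h2]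
  rw [hsplit, ← Finset.prod_range_reflect (fun k => 1 - ω ^ (2 * k + 1 + 1)),
    Finset.prod_congr rfl hconj, ← map_prod, Complex.mul_conj, Complex.normSq_eq_norm_sq] at h1
  have h2 : ‖∏ k ∈ Finset.range p, (1 - ω ^ (2 * k + 1))‖ ^ 2 = ((2 * p + 1 : ℕ) : ℝ) := by
    have h3 : ((‖∏ k ∈ Finset.range p, (1 - ω ^ (2 * k + 1))‖ ^ 2 : ℝ) : ℂ) =
        (((2 * p + 1 : ℕ) : ℝ) : ℂ) := by rw [h1]; push_cast; ring
    exact_mod_cast h3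
  rw [← h2, Real.sqrt_sq (norm_nonneg _)]

/-- The modulus being known, only phases have to be multiplied; the exponent `p²` is the sum of the
first `p` odd numbers. -/
lemma prod_one_sub_pow_eq {ω u v : ℂ} {p : ℕ} (hω : IsPrimitiveRoot ω (2 * p + 1))
    (hu : ‖u‖ = 1) (hv : ‖v‖ = 1)
    (h : ∀ k < p, ∃ s : ℝ, 0 < s ∧ 1 - ω ^ (2 * k + 1) = v * u ^ (2 * k + 1) * s) :
    ∏ k ∈ Finset.range p, (1 - ω ^ (2 * k + 1)) =
      v ^ p * u ^ (p ^ 2) * (Real.sqrt ((2 * p + 1 : ℕ) : ℝ) : ℂ) := by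
  have key : ∀ m ≤ p, ∃ s : ℝ, 0 < s ∧
      ∏ k ∈ Finset.range m, (1 - ω ^ (2 * k + 1)) = v ^ m * u ^ (m ^ 2) * s := by
    intro m
    induction m with
    | zero => exact fun _ => ⟨1, one_pos, by simp⟩
    | succ m ih =>
      intro hm
      obtain ⟨s, hs, h1⟩ := ih (by omega)
      obtain ⟨t, ht, h2⟩ := h m (by omega)
      refine ⟨s * t, mul_pos hs ht, ?_⟩
      rw [Finset.prod_range_succ, h1, h2]
      push_cast
      ring
  obtain ⟨s, hs, h1⟩ := key p le_rfl
  have h2 := norm_prod_one_sub_pow hω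
  rw [h1, norm_mul, norm_mul, norm_pow, norm_pow, hu, hv, one_pow, one_pow, one_mul, one_mul,
    Complex.norm_real, Real.norm_of_nonneg hs.le] at h2
  rw [h1, h2]

lemma one_sub_exp_pow (θ : ℝ) (k : ℕ) :
    1 - (Complex.exp (θ * Complex.I) ^ 2) ^ k =
      -Complex.I * Complex.exp (θ * Complex.I) ^ k * ((2 * Real.sin (k * θ) : ℝ) : ℂ) := by
  rw [pow_right_comm, ← Complex.exp_nat_mul, ← mul_assoc]
  push_cast
  rw [Complex.exp_mul_I]
  have h1 := Complex.sin_sq_add_cos_sq ((k : ℂ) * θ)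
  linear_combination (Complex.sin ((k : ℂ) * θ)) ^ 2 * Complex.I_sq - h1

lemma one_add_exp_pow (θ : ℝ) (k : ℕ) :
    1 + (Complex.exp (θ * Complex.I) ^ 2) ^ k =
      1 * Complex.exp (θ * Complex.I) ^ k * ((2 * Real.cos (k * θ) : ℝ) : ℂ) := by
  rw [pow_right_comm, ← Complex.exp_nat_mul, ← mul_assoc]
  push_cast
  rw [Complex.exp_mul_I]
  have h1 := Complex.sin_sq_add_cos_sq ((k : ℂ) * θ)
  linear_combination (Complex.sin ((k : ℂ) * θ)) ^ 2 * Complex.I_sq - h1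

/-- The quadratic Gauss sum at `x ^ 2` for `x = exp (πi / n)`, `n` odd. -/
theorem sum_triangular_exp (p : ℕ) {x : ℂ}
    (hx : x = Complex.exp ((Real.pi / (2 * p + 1 : ℕ) : ℝ) * Complex.I))
    (hω : IsPrimitiveRoot (x ^ 2) (2 * p + 1)) :
    ∑ i ∈ Finset.range (2 * p + 1), (x ^ 2)⁻¹ ^ (i * (i + 1) / 2) =
      (-Complex.I) ^ p * x ^ (p ^ 2) * (Real.sqrt ((2 * p + 1 : ℕ) : ℝ) : ℂ) := by
  rw [sum_inv_pow_triangular hω]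
  refine prod_one_sub_pow_eq hω ?_ (by simp) ?_
  · rw [hx, Complex.norm_exp_ofReal_mul_I]
  · intro k hk
    -- Half-angle formula; `k < p` keeps the angle strictly between 0 and `π`.
    refine ⟨2 * Real.sin (((2 * k + 1 : ℕ) : ℝ) * (Real.pi / (2 * p + 1 : ℕ))), ?_, ?_⟩
    · have hk' : ((2 * k + 1 : ℕ) : ℝ) < (2 * p + 1 : ℕ) := by exact_mod_cast (by omega)
      have hpos : (0 : ℝ) < (2 * p + 1 : ℕ) := by positivity
      refine mul_pos two_pos (Real.sin_pos_of_pos_of_lt_pi (by positivity) ?_)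
      rw [mul_div_assoc', div_lt_iff₀ hpos, mul_comm]
      exact mul_lt_mul_of_pos_left hk' Real.pi_pos
    · rw [hx, one_sub_exp_pow]

/-- The quadratic Gauss sum at `-y ^ 2` for `y = exp (πi / 2n)`, `n` odd. -/
theorem sum_triangular_neg_exp (p : ℕ) {y : ℂ}
    (hy : y = Complex.exp ((Real.pi / (2 * (2 * p + 1 : ℕ)) : ℝ) * Complex.I))
    (hω : IsPrimitiveRoot (-y ^ 2) (2 * p + 1)) :
    ∑ i ∈ Finset.range (2 * p + 1), (-y ^ 2)⁻¹ ^ (i * (i + 1) / 2) =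
      y ^ (p ^ 2) * (Real.sqrt ((2 * p + 1 : ℕ) : ℝ) : ℂ) := by
  rw [sum_inv_pow_triangular hω]
  refine (prod_one_sub_pow_eq (u := y) (v := 1) hω ?_ norm_one ?_).trans (by rw [one_pow, one_mul])
  · rw [hy, Complex.norm_exp_ofReal_mul_I]
  · intro k hk
    -- An odd power of `-y²` turns the difference into a sum, hence a cosine, and the angle stays
    -- below `π/2`.
    refine ⟨2 * Real.cos (((2 * k + 1 : ℕ) : ℝ) * (Real.pi / (2 * (2 * p + 1 : ℕ)))), ?_, ?_⟩
    · have hk' : ((2 * k + 1 : ℕ) : ℝ) < (2 * p + 1 : ℕ) := by exact_mod_cast (by omega)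
      have hpos : (0 : ℝ) < (2 * p + 1 : ℕ) := by positivity
      have hpi := Real.pi_pos
      refine mul_pos two_pos (Real.cos_pos_of_mem_Ioo ⟨?_, ?_⟩)
      · exact lt_trans (by linarith) (by positivity : (0 : ℝ) < _)
      · rw [mul_div_assoc', div_lt_div_iff₀ (by positivity) two_pos]
        have := mul_lt_mul_of_pos_left hk' hpi
        linarith
    · rw [Odd.neg_pow (odd_two_mul_add_one k), sub_neg_eq_add, hy, one_add_exp_pow]

lemma pow_triangular_add {w : ℂ} {p : ℕ} (hw : w ^ (2 * p + 1) = 1) (i : ℕ) :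
    w ^ ((i + (2 * p + 1)) * (i + (2 * p + 1) + 1) / 2) = w ^ (i * (i + 1) / 2) := by
  have h : (i + (2 * p + 1)) * (i + (2 * p + 1) + 1) / 2 =
      i * (i + 1) / 2 + (2 * p + 1) * (i + p + 1) := by
    rw [show (i + (2 * p + 1)) * (i + (2 * p + 1) + 1) =
      i * (i + 1) + 2 * ((2 * p + 1) * (i + p + 1)) by ring, Nat.add_mul_div_left _ _ two_pos]
  rw [h, pow_add, pow_mul, hw, one_pow, mul_one]

/-- As 2 is invertible modulo the odd number `n`, `c ↦ 2c + h` permutes the residues. -/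
lemma sum_range_two_mul_add {n h : ℕ} (hn : Odd n) {f : ℕ → ℂ} (hf : Function.Periodic f n) :
    ∑ c ∈ Finset.range n, f (2 * c + h) = ∑ j ∈ Finset.range n, f j := by
  have hmaps : Set.MapsTo (fun c => (2 * c + h) % n) (Finset.range n) (Finset.range n) := by
    intro c _
    simpa using Nat.mod_lt _ hn.pos
  have hinj : Set.InjOn (fun c => (2 * c + h) % n) (Finset.range n) := by
    intro c hc d hd hcd
    have h1 : 2 * c + h ≡ 2 * d + h [MOD n] := hcd
    have h2 : c ≡ d [MOD n] :=
      Nat.ModEq.cancel_left_of_coprime (Nat.coprime_two_right.2 hn) (h1.add_right_cancel' h)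
    rwa [Nat.ModEq, Nat.mod_eq_of_lt (by simpa using hc), Nat.mod_eq_of_lt (by simpa using hd)]
      at h2
  refine Finset.sum_nbij (fun c => (2 * c + h) % n) hmaps hinj
    (Finset.surjOn_of_injOn_of_card_le _ hmaps hinj le_rfl) fun c _ => ?_
  exact (hf.map_mod_nat _).symm

/-- Completing the square. -/
lemma sum_inv_pow_two_mul {ω : ℂ} {p : ℕ} (hω : ω ^ (2 * p + 1) = 1) :
    ∑ c ∈ Finset.range (2 * p + 1), (ω⁻¹ ^ 2) ^ (c * (c + 1)) =
      ω ^ ((p + 1) * (p + 2) / 2) *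
        ∑ i ∈ Finset.range (2 * p + 1), ω⁻¹ ^ (i * (i + 1) / 2) := by
  have h0 : ω ≠ 0 := by rintro rfl; simp at hω
  have hw : ω⁻¹ ^ (2 * p + 1) = 1 := by rw [inv_pow, hω, inv_one]
  rw [← sum_range_two_mul_add (h := p + 1) (odd_two_mul_add_one p)
    (f := fun i => ω⁻¹ ^ (i * (i + 1) / 2)) (fun i => pow_triangular_add hw i), Finset.mul_sum]
  refine Finset.sum_congr rfl fun c _ => ?_
  -- The shift `p + 1` is the inverse of 2 modulo `2p + 1`, which makes the linear term in `c` agree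
  -- up to a multiple of `2p + 1`.
  have h : (2 * c + (p + 1)) * (2 * c + (p + 1) + 1) / 2 =
      (p + 1) * (p + 2) / 2 + (2 * (c * (c + 1)) + (2 * p + 1) * c) := by
    rw [show (2 * c + (p + 1)) * (2 * c + (p + 1) + 1) =
      (p + 1) * (p + 2) + 2 * (2 * (c * (c + 1)) + (2 * p + 1) * c) by ring,
      Nat.add_mul_div_left _ _ two_pos]
  rw [h, pow_add, pow_add, pow_mul _ (2 * p + 1), hw, one_pow, mul_one, ← mul_assoc, ← mul_pow,
    mul_inv_cancel₀ h0, one_pow, one_mul, pow_mul _ 2]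

end GaussSum

/-! ### The value of the stabilization coefficient -/

section Value

lemma exp_eq_pow {a b : ℂ} (n : ℕ) (h : a = n * b) : Complex.exp a = Complex.exp b ^ n := by
  rw [h, Complex.exp_nat_mul]

lemma sqrt_div_mul_sqrt (n : ℕ) (hn : n ≠ 0) (a b : ℂ) :
    (Real.sqrt (n : ℝ) : ℂ) / n * a * (b * (Real.sqrt (n : ℝ) : ℂ)) = a * b := by
  have h : (Real.sqrt (n : ℝ) : ℂ) * (Real.sqrt (n : ℝ) : ℂ) = n := by
    rw [← Complex.ofReal_mul, Real.mul_self_sqrt (Nat.cast_nonneg n)]; simp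
  have hn' : (n : ℂ) ≠ 0 := Nat.cast_ne_zero.2 hn
  field_simp
  linear_combination a * b * h

lemma r'_two_mul_odd (p : ℕ) : r' (2 * (2 * p + 1)) = 2 * p + 1 := by
  rw [r', Nat.gcd_eq_right ⟨_, rfl⟩, Nat.mul_div_cancel_left _ two_pos]

lemma r''_four_mul_odd (p : ℕ) : r'' (4 * (2 * p + 1)) = 2 * p + 1 := by
  rw [r'', Nat.gcd_eq_right ⟨_, rfl⟩, Nat.mul_div_cancel_left _ four_pos]

/-- Collects the prefactor, the constant from completing the square and the phase of the Gauss sum.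
Powers of `x^(2p+1)` are kept apart because it equals `-1` or `i` in the two applications. -/
lemma pow_triangle_mul (x : ℂ) (p : ℕ) :
    (x ^ 2) ^ ((2 * p + 1 - 1) * (2 * p + 1 - 2) / 2) * (x ^ 2) ^ ((p + 1) * (p + 2) / 2) *
      x ^ (p ^ 2) * (x ^ (2 * p + 1)) ^ 2 = (x ^ 2) ^ (p + 2) * ((x ^ (2 * p + 1)) ^ 3) ^ p := by
  have e1 : (2 * p + 1 - 1) * (2 * p + 1 - 2) / 2 + p = 2 * p * p := by
    rcases p with _ | p
    · rfl
    · rw [show 2 * (p + 1) + 1 - 1 = 2 * (p + 1) by omega,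
        show 2 * (p + 1) + 1 - 2 = 2 * p + 1 by omega, mul_assoc,
        Nat.mul_div_cancel_left _ two_pos]
      ring
  have e2 : (p + 1) * (p + 2) / 2 * 2 = (p + 1) * (p + 2) := triangular_mul_two (p + 1)
  generalize (2 * p + 1 - 1) * (2 * p + 1 - 2) / 2 = a at *
  generalize (p + 1) * (p + 2) / 2 = t at *
  simp only [← pow_mul, ← pow_add]
  congr 1
  linear_combination 2 * e1 + e2

/-- With `x` the square root `exp(πi/r)` of `q`, `x^r = -1`; the resulting `(-1)^p` cancels the sign
in `(-i)^p`. -/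
theorem IsPreferred.apply_ribbonElement_odd {p : ℕ} (hp : 0 < p) {lam : Uq (2 * p + 1) →ₗ[ℂ] ℂ}
    (h : IsPreferred (2 * p + 1) lam) :
    lam (ribbonElement (2 * p + 1)) = Complex.I ^ p * q (2 * p + 1) ^ (p + 2) := by
  have hr' : r' (2 * p + 1) = 2 * p + 1 := by
    rw [r', (Nat.coprime_two_right.2 (odd_two_mul_add_one p)).gcd_eq_one, Nat.div_one]
  have hr'' : r'' (2 * p + 1) = 2 * p + 1 := by
    have : Nat.Coprime (2 * p + 1) (2 ^ 2) :=
      (Nat.coprime_two_right.2 (odd_two_mul_add_one p)).pow_right 2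
    rw [r'', show 4 = 2 ^ 2 by norm_num, this.gcd_eq_one, Nat.div_one]
  obtain ⟨x, hx⟩ : ∃ x, x = Complex.exp ((Real.pi / (2 * p + 1 : ℕ) : ℝ) * Complex.I) := ⟨_, rfl⟩
  have hn : ((2 * p + 1 : ℕ) : ℂ) ≠ 0 := Nat.cast_ne_zero.2 (by omega)
  have hq : q (2 * p + 1) = x ^ 2 := by
    rw [q, hx]
    refine exp_eq_pow 2 ?_
    rw [Complex.ofReal_div, Complex.ofReal_natCast]
    push_cast
    ring
  have hxn : x ^ (2 * p + 1) = -1 := by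
    rw [hx, ← exp_eq_pow (2 * p + 1) (a := Real.pi * Complex.I), Complex.exp_pi_mul_I]
    rw [Complex.ofReal_div, Complex.ofReal_natCast]
    field_simp
  have hprim : IsPrimitiveRoot (x ^ 2) (2 * p + 1) := by
    rw [← hq]; exact Complex.isPrimitiveRoot_exp _ (by omega)
  rw [h.apply_ribbonElement (by omega), hr', hr'', hq, sum_inv_pow_two_mul hprim.pow_eq_one,
    sum_triangular_exp p hx hprim, ← mul_assoc ((x ^ 2) ^ _), sqrt_div_mul_sqrt _ (by omega)]
  have e4 := pow_triangle_mul x p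
  rw [hxn, neg_one_sq, mul_one, Odd.neg_one_pow (by decide)] at e4
  have e5 : (-1 : ℂ) ^ p * (-1) ^ p = 1 := by rw [← mul_pow]; simp
  rw [neg_pow]
  linear_combination (-1) ^ p * Complex.I ^ p * e4 + Complex.I ^ p * (x ^ 2) ^ (p + 2) * e5

/-- The sign relating the Gauss sums at `-q` and the Jacobi symbol. -/
lemma jacobiSym_two_eq (p : ℕ) :
    (jacobiSym 2 (2 * p + 1) : ℂ) = -((-1) ^ p * (-1) ^ ((p + 1) * (p + 2) / 2)) := by
  -- Both sides depend only on `p` modulo 4, that is on `2p + 1` modulo 8.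
  obtain ⟨k, c, hc, rfl⟩ : ∃ k c, c < 4 ∧ p = 4 * k + c :=
    ⟨p / 4, p % 4, Nat.mod_lt _ (by norm_num), (Nat.div_add_mod p 4).symm⟩
  have h1 : jacobiSym 2 (2 * (4 * k + c) + 1) = ZMod.χ₈ ((2 * c + 1 : ℕ) : ZMod 8) := by
    have h2 := jacobiSym.at_two (odd_two_mul_add_one (4 * k + c))
    rw [h2]
    congr 1
    have h3 : (8 : ZMod 8) = 0 := rfl
    push_cast
    linear_combination (k : ZMod 8) * h3
  have h2 : (4 * k + c + 1) * (4 * k + c + 2) / 2 =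
      (c + 1) * (c + 2) / 2 + 2 * (4 * k ^ 2 + 2 * k * c + 3 * k) := by
    rw [show (4 * k + c + 1) * (4 * k + c + 2) =
      (c + 1) * (c + 2) + 2 * (2 * (4 * k ^ 2 + 2 * k * c + 3 * k)) by ring,
      Nat.add_mul_div_left _ _ two_pos]
  have h3 : ∀ c < 4, ZMod.χ₈ ((2 * c + 1 : ℕ) : ZMod 8) =
      -((-1) ^ c * (-1) ^ ((c + 1) * (c + 2) / 2)) := by decide
  rw [h1, h2, h3 c hc, pow_add, pow_add, pow_mul, pow_mul]
  norm_num

/-- Here `q` has even order, so the square is completed at `-q`, which has odd order `r'` and the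
same square. The extra sign `(-1)^((p+1)(p+2)/2)` is what yields the Jacobi symbol. -/
theorem IsPreferred.apply_ribbonElement_two_mul_odd {p : ℕ} (hp : 0 < p)
    [NeZero (2 * (2 * p + 1))] {lam : Uq (2 * (2 * p + 1)) →ₗ[ℂ] ℂ}
    (h : IsPreferred (2 * (2 * p + 1)) lam) :
    lam (ribbonElement (2 * (2 * p + 1))) =
      (jacobiSym 2 (2 * p + 1) : ℂ) * Complex.I ^ p * q (2 * (2 * p + 1)) ^ (p + 2) := by
  have hr' := r'_two_mul_odd p
  have hr'' : r'' (2 * (2 * p + 1)) = 2 * p + 1 := by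
    rw [r'', show 4 = 2 * 2 by norm_num, Nat.gcd_mul_left,
      (Nat.coprime_two_right.2 (odd_two_mul_add_one p)).gcd_eq_one,
      Nat.mul_div_mul_left _ _ two_pos, Nat.div_one]
  obtain ⟨y, hy⟩ : ∃ y, y = Complex.exp ((Real.pi / (2 * (2 * p + 1 : ℕ)) : ℝ) * Complex.I) :=
    ⟨_, rfl⟩
  have hn : ((2 * p + 1 : ℕ) : ℂ) ≠ 0 := Nat.cast_ne_zero.2 (by omega)
  have hn' : (2 * (p : ℂ) + 1) ≠ 0 := by exact_mod_cast hn
  have hq : q (2 * (2 * p + 1)) = y ^ 2 := by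
    rw [q, hy]
    refine exp_eq_pow 2 ?_
    push_cast
    field_simp
  have hyn : y ^ (2 * p + 1) = Complex.I := by
    rw [hy, ← exp_eq_pow (2 * p + 1) (a := Real.pi / 2 * Complex.I), Complex.exp_pi_div_two_mul_I]
    push_cast
    field_simp
  have hprim : IsPrimitiveRoot (-y ^ 2) (2 * p + 1) := by
    have h1 : IsPrimitiveRoot ((y ^ 2) ^ 2) (2 * p + 1) := by
      have h2 := isPrimitiveRoot_q_sq (NeZero.ne (2 * (2 * p + 1)))
      rwa [hq, hr'] at h2
    have h3 : -y ^ 2 = ((y ^ 2) ^ 2) ^ (p + 1) := by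
      rw [← pow_mul, ← pow_mul, show 2 * (2 * (p + 1)) = (2 * p + 1) * 2 + 2 by ring, pow_add,
        pow_mul, hyn, Complex.I_sq]
      ring
    rw [h3]
    refine h1.pow_of_coprime _ ?_
    rw [show 2 * p + 1 = p + (p + 1) by ring]
    simp
  have hG := sum_inv_pow_two_mul hprim.pow_eq_one
  rw [sum_triangular_neg_exp p hy hprim, inv_neg, neg_sq] at hG
  rw [h.apply_ribbonElement (by omega), hr', hr'', hq, hG, ← mul_assoc ((-y ^ 2) ^ _),
    sqrt_div_mul_sqrt _ (by omega), jacobiSym_two_eq]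
  have e4 := pow_triangle_mul y p
  rw [hyn, Complex.I_sq, Complex.I_pow_three, neg_pow Complex.I] at e4
  rw [neg_pow (y ^ 2)]
  linear_combination -(-1) ^ ((p + 1) * (p + 2) / 2) * e4

/-- The summand is already a triangular power of `q^(-4)`, and `q^4` has odd order `r''`, so no
square is completed. The range `r' = 2r''` covers two periods. -/
theorem IsPreferred.apply_ribbonElement_four_mul_odd {p : ℕ}
    [NeZero (4 * (2 * p + 1))] {lam : Uq (4 * (2 * p + 1)) →ₗ[ℂ] ℂ}
    (h : IsPreferred (4 * (2 * p + 1)) lam) :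
    lam (ribbonElement (4 * (2 * p + 1))) = -q (4 * (2 * p + 1)) ^ (p + 2) := by
  have hr' : r' (4 * (2 * p + 1)) = 2 * (2 * p + 1) := by
    rw [r', Nat.gcd_eq_right ⟨2 * (2 * p + 1), by ring⟩]
    omega
  have hr'' := r''_four_mul_odd p
  have hn : ((2 * p + 1 : ℕ) : ℂ) ≠ 0 := Nat.cast_ne_zero.2 (by omega)
  have hn' : (2 * (p : ℂ) + 1) ≠ 0 := by exact_mod_cast hn
  obtain ⟨z, hz⟩ : ∃ z, z = q (4 * (2 * p + 1)) := ⟨_, rfl⟩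
  have hx : z ^ 2 = Complex.exp ((Real.pi / (2 * p + 1 : ℕ) : ℝ) * Complex.I) := by
    rw [hz, q]
    refine (exp_eq_pow 2 ?_).symm
    push_cast
    field_simp
    ring
  have hzn : z ^ (2 * p + 1) = Complex.I := by
    rw [hz, q, ← exp_eq_pow (2 * p + 1) (a := Real.pi / 2 * Complex.I),
      Complex.exp_pi_div_two_mul_I]
    push_cast
    field_simp
    ring
  have hprim : IsPrimitiveRoot ((z ^ 2) ^ 2) (2 * p + 1) := by
    have h1 : IsPrimitiveRoot z (4 * (2 * p + 1)) := by
      rw [hz]; exact Complex.isPrimitiveRoot_exp _ (NeZero.ne _)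
    rw [← pow_mul]
    exact h1.pow (by omega) rfl
  have hw : ((z ^ 2) ^ 2)⁻¹ ^ (2 * p + 1) = 1 := by rw [inv_pow, hprim.pow_eq_one, inv_one]
  have hG : ∑ c ∈ Finset.range (2 * (2 * p + 1)), (z⁻¹ ^ 2) ^ (c * (c + 1)) =
      2 * ((-Complex.I) ^ p * (z ^ 2) ^ (p ^ 2) * (Real.sqrt ((2 * p + 1 : ℕ) : ℝ) : ℂ)) := by
    have h1 : ∀ c : ℕ, (z⁻¹ ^ 2) ^ (c * (c + 1)) = ((z ^ 2) ^ 2)⁻¹ ^ (c * (c + 1) / 2) := by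
      intro c
      conv_lhs => rw [← triangular_mul_two c]
      rw [mul_comm, pow_mul, inv_pow, inv_pow]
    simp only [h1]
    rw [two_mul (2 * p + 1), Finset.sum_range_add, ← sum_triangular_exp p hx hprim,
      two_mul (∑ i ∈ _, _)]
    congr 1
    refine Finset.sum_congr rfl fun c _ => ?_
    rw [add_comm (2 * p + 1) c, pow_triangular_add hw]
  rw [h.apply_ribbonElement (by omega), hr', hr'', ← hz, hG]
  have e0 : (2 * (2 * p + 1) - 1) * (2 * (2 * p + 1) - 2) / 2 = 8 * p ^ 2 + 2 * p := by
    rw [show 2 * (2 * p + 1) - 1 = 4 * p + 1 by omega, show 2 * (2 * p + 1) - 2 = 4 * p by omega,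
      show (4 * p + 1) * (4 * p) = 2 * (8 * p ^ 2 + 2 * p) by ring,
      Nat.mul_div_cancel_left _ two_pos]
  have e1 := sqrt_div_mul_sqrt (2 * p + 1) (by omega) (z ^ (8 * p ^ 2 + 2 * p))
    ((-Complex.I) ^ p * (z ^ 2) ^ (p ^ 2))
  have e2 : (Real.sqrt ((2 * p + 1 : ℕ) : ℝ) : ℂ) / (2 * (2 * p + 1) : ℕ) *
      z ^ (8 * p ^ 2 + 2 * p) * (2 * ((-Complex.I) ^ p * (z ^ 2) ^ (p ^ 2) *
        (Real.sqrt ((2 * p + 1 : ℕ) : ℝ) : ℂ))) =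
      z ^ (8 * p ^ 2 + 2 * p) * ((-Complex.I) ^ p * (z ^ 2) ^ (p ^ 2)) := by
    rw [← e1]
    push_cast
    field_simp
  -- Every phase becomes a power of `z = q`, so that only exponents remain to be compared.
  have e3 : -Complex.I = z ^ ((2 * p + 1) * 3) := by rw [pow_mul, hzn, Complex.I_pow_three]
  have e4 : z ^ (8 * p ^ 2 + 2 * p) * (z ^ ((2 * p + 1) * 3 * p) * z ^ (2 * p ^ 2)) *
      (z ^ (2 * p + 1)) ^ 2 = z ^ (p + 2) * ((z ^ (2 * p + 1)) ^ 4) ^ (2 * p) := by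
    ring
  rw [e0, e2, e3, ← pow_mul z, ← pow_mul z]
  rw [hzn, Complex.I_sq, Complex.I_pow_four, one_pow] at e4
  linear_combination -e4

/-- Replacing `c` by `c + r'/2` changes `c(c+1)` by an odd multiple of `r'/2`, and `(q^(-2))^(r'/2)
= -1`, so the two halves of the sum cancel. -/
theorem IsPreferred.apply_ribbonElement_eight_mul {k : ℕ} [NeZero (8 * k)]
    {lam : Uq (8 * k) →ₗ[ℂ] ℂ} (h : IsPreferred (8 * k) lam) :
    lam (ribbonElement (8 * k)) = 0 := by
  have hk : 8 * k ≠ 0 := NeZero.ne _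
  have hr' : r' (8 * k) = 2 * k + 2 * k := by
    rw [r', Nat.gcd_eq_right ⟨4 * k, by ring⟩]
    omega
  have hprim : IsPrimitiveRoot ((q (8 * k))⁻¹ ^ 2) ((2 * k) * 2) := by
    have h1 := (isPrimitiveRoot_q_sq hk).inv
    rwa [hr', ← mul_two, ← inv_pow] at h1
  have h2 : ((q (8 * k))⁻¹ ^ 2) ^ (2 * k) = -1 :=
    (hprim.pow (by omega) rfl).eq_neg_one_of_two_right
  have hG : ∑ c ∈ Finset.range (2 * k + 2 * k), ((q (8 * k))⁻¹ ^ 2) ^ (c * (c + 1)) = 0 := by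
    rw [Finset.sum_range_add, ← Finset.sum_add_distrib]
    refine Finset.sum_eq_zero fun c _ => ?_
    have h3 : (2 * k + c) * (2 * k + c + 1) = c * (c + 1) + (2 * k) * (2 * (c + k) + 1) := by ring
    rw [h3, pow_add, pow_mul _ (2 * k), h2, Odd.neg_one_pow (odd_two_mul_add_one _)]
    ring
  rw [h.apply_ribbonElement (by omega), hr', hG, mul_zero]

end Value

end

end SmallQuantum


/-! ### The theorem, by residue class of `r`. -/

theorem lemmaL (r : ℕ) [NeZero r] (hr : 2 < r) :
    (∃! lam : SmallQuantum.Uq r →ₗ[ℂ] ℂ, SmallQuantum.IsPreferred r lam) ∧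
    ∀ lam : SmallQuantum.Uq r →ₗ[ℂ] ℂ, SmallQuantum.IsPreferred r lam →
      SmallQuantum.IsLeftIntegral lam ∧
      (r % 2 = 1 →
        lam (SmallQuantum.ribbonElement r) =
          Complex.I ^ ((r - 1) / 2) * SmallQuantum.q r ^ ((r + 3) / 2)) ∧
      (r % 4 = 2 →
        lam (SmallQuantum.ribbonElement r) =
          (jacobiSym 2 (SmallQuantum.r' r) : ℂ) * Complex.I ^ ((SmallQuantum.r' r - 1) / 2) *
            SmallQuantum.q r ^ ((SmallQuantum.r' r + 3) / 2)) ∧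
      (r % 8 = 4 →
        lam (SmallQuantum.ribbonElement r) =
          -SmallQuantum.q r ^ ((SmallQuantum.r'' r + 3) / 2)) ∧
      (r % 8 = 0 → lam (SmallQuantum.ribbonElement r) = 0) := by
  refine ⟨⟨SmallQuantum.integral hr, SmallQuantum.isPreferred_integral hr,
    fun mu hmu => hmu.unique (SmallQuantum.isPreferred_integral hr)⟩, fun lam hlam =>
    ⟨hlam.isLeftIntegral, fun h => ?_, fun h => ?_, fun h => ?_, fun h => ?_⟩⟩
  · obtain ⟨p, rfl⟩ : ∃ p, r = 2 * p + 1 := ⟨r / 2, by omega⟩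
    rw [hlam.apply_ribbonElement_odd (by omega), show (2 * p + 1 - 1) / 2 = p by omega,
      show (2 * p + 1 + 3) / 2 = p + 2 by omega]
  · obtain ⟨p, rfl⟩ : ∃ p, r = 2 * (2 * p + 1) := ⟨r / 4, by omega⟩
    rw [hlam.apply_ribbonElement_two_mul_odd (by omega), SmallQuantum.r'_two_mul_odd,
      show (2 * p + 1 - 1) / 2 = p by omega, show (2 * p + 1 + 3) / 2 = p + 2 by omega]
  · obtain ⟨p, rfl⟩ : ∃ p, r = 4 * (2 * p + 1) := ⟨r / 8, by omega⟩
    rw [hlam.apply_ribbonElement_four_mul_odd, SmallQuantum.r''_four_mul_odd,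
      show (2 * p + 1 + 3) / 2 = p + 2 by omega]
  · obtain ⟨k, rfl⟩ : ∃ k, r = 8 * k := ⟨r / 8, by omega⟩
    exact hlam.apply_ribbonElement_eight_mul
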